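/- **Setting.** A *time domain* is a totally ordered semiring $\mathbb T$ (order strictly compatible with $+$ and with multiplication by positive elements) in which $s\le t$ holds iff $t=s+x$ for some $x$; so $0$ is the least element and $t-s$ exists for $s\le t$. An *event stream* over $D$ is a function $s:\mathbb T\to D\cup\{\bot,?\}$ ($\bot$: known to have no event; $?$: unknown) such that the set of *known* timestamps $\{t: s(t)\neq ?\}$ is downward closed and below each known timestamp there are only finitely many events, i.e. $t$ with $s(t)\in D$ ("$s$ ticks at $t$"). $s$ is a *prefix* of $r$ if $s(t)\in\{r(t),?\}$ for all $t$. $\mathbb U=\{\square\}$ is the unit type. **Concrete operators.** $\mathrm{nil}(t)=\bot$ for all $t$; $\mathrm{unit}$ has the single event $\square$ at $0$ and is $\bot$ elsewhere; $\mathrm{time}(s)$ replaces each event value by its timestamp; $\mathrm{lift}(f)(s_1,\dots,s_n)(t)=f(s_1(t),\dots,s_n(t))$ if all $s_i(t)\ne ?$, and $?$ otherwise, for $f:\prod_i(D_i\cup\{\bot\})\to D\cup\{\bot\}$ with $f(\bot,\dots,\bot)=\bot$. $z=\mathrm{last}(v,r)$: $z(t)=d$ if $r$ ticks at $t$ and $d$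 is the value of the last event of $v$ before $t$ (with $v=\bot$ in between); $z(t)=\bot$ if $r(t)=\bot$ and $z$ is known before $t$, or if $v=\bot$ at all times before $t$; otherwise $z(t)=?$. $z=\mathrm{delay}(d,r)$, with $d$ over $\mathbb T\setminus\{0\}$: $z(t)=\square$ if for some $t'<t$, $d(t')=t-t'$, $z(t')=\square$ or $r$ ticks at $t'$, and $r=\bot$ on $(t',t)$; $z(t)=\bot$ if $z$ is known before $t$ and for each $t'<t$ either $d(t')\notin\{t-t',?\}$, or $z(t')=r(t')=\bot$, or $r$ ticks in $(t',t)$; otherwise $?$. Where such a description refers to $z$ itself, $z$ is the stream with the largest progress that satisfies it; in particular the output of $\mathrm{delay}$ ends where its events accumulate. A *TeSSLa specification* consists of finitely many stream variables with one (possibly recursive) equation each, whose right-hand sides are expressions built from the variables, the input streams and the concrete operators, over arbitrary data domains and with arbitrary functions in $\mathrm{lift}$. Its semantics on given inputs is the least solution in the prefix order. Outputs are given by expressions of the same kind. **Abstract streams.** A *data abstraction* of $D$ is a set $D^\#$ with $\gamma:D^\#\to 2^D$ and $\top\in D^\#$, $\gamma(\top)=D$; it *contains the concrete values* if it is given with elements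 $d\in D^\#$, $\gamma(d)=\{d\}$, for all $d\in D$. An *abstract event stream* over $D$ is a pair $a=(s,\Delta)$ of an event stream $s$ over $D^\#$ and a set $\Delta\subseteq\mathbb T$ such that $s(t)\ne\bot$ implies $t\in\Delta$, and on the known part of $s$ the set $\Delta$ is described by the events of an event stream $e$ over the six changes: inclusive/exclusive start, inclusive/exclusive end, point-wise gap, point-wise event in a gap. (The latest event of $e$ up to and including $t$ decides whether $t\in\Delta$; $t\in\Delta$ if there is none.) If $e$ is known exactly where $s$ is, the pair $(s,e)$ of concrete event streams *encodes* $a$. We regard $a$ as the function with $a(t)=s(t)$ for $t\in\Delta$ and $a(t)=\circ$ ("gap") for $t\notin\Delta$; "$a$ ticks at $t$" means $a(t)\in D^\#$. **Abstract operators** (each output is given as a function of $t$; again, with the largest progress). * $\mathrm{nil}^\#$ and $\mathrm{unit}^\#$ are the concrete streams without gaps; $\mathrm{time}^\#$ replaces event values by their timestamps and keeps $\bot,\circ,?$. * $\mathrm{lift}^\#(f^\#)(s_1,\dots,s_n)(t)=f^\#(s_1(t),\dots,s_n(t))$ if no $s_i(t)$ is $?$, and $?$ otherwise. Here $f^\#:\prod_i(D_i^\#\cup\{\bot,\circ\})\to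 D^\#\cup\{\bot,\circ\}$ is an abstraction of some $f$ with $f(\bot,\dots,\bot)=\bot$: $x_i\in\gamma_\bot(b_i)$ for all $i$ implies $f(x)\in\gamma_\bot(f^\#(b))$, where $\gamma_\bot(\bot)=\{\bot\}$, $\gamma_\bot(\circ)=D\cup\{\bot\}$, $\gamma_\bot=\gamma$ on $D^\#$. * $z=\mathrm{last}^\#(v,r)$: $z(t)=d$ if $r$ ticks at $t$, $v(t')=d\in D^\#$ for some $t'<t$ and $v=\bot$ on $(t',t)$; $z(t)=\top$ if $r$ ticks at $t$, and for some $t'<t$, $v$ ticks at $t'$ and on $(t',t)$ takes only the values $\bot,\circ$, and $\circ$ at least once; $z(t)=\bot$ if $r(t)=\bot$ and $z$ is known before $t$, or $v=\bot$ at all times before $t$; $z(t)=\circ$ if $z$ is known before $t$ and either $r(t)=\circ$ and $v$ has an event or a gap before $t$, or $r$ ticks at $t$ and before $t$ the stream $v$ takes only the values $\bot,\circ$, and $\circ$ at least once; otherwise $z(t)=?$. * $z=\mathrm{delay}^\#(d,r)$, with $d$ over a data abstraction of $\mathbb T_\infty\setminus\{0\}$ that contains the concrete values: let $\mathrm{must}\subseteq\mathbb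 T$ be the least set with $t\in\mathrm{must}$ whenever for some $t'<t$: $d(t')=t-t'$, $r$ ticks at $t'$ or $t'\in\mathrm{must}$, and $r=\bot$ on $(t',t)$. Let $\mathrm{may}\subseteq\mathbb T$ be the least set with $t\in\mathrm{may}$ whenever for some $t'<t$: $d(t')\in\{t-t',\top,\circ\}$, $r(t')$ is an event or $\circ$ or $t'\in\mathrm{may}$, and $r\in\{\bot,\circ\}$ on $(t',t)$. Call $t$ *settled* if one of the following holds. (a) $t\in\mathrm{must}$. (b) For each $t'<t$ either $d(t')\notin\{t-t',\top,\circ,?\}$, or $t'\notin\mathrm{may}$ and $r(t')=\bot$, or $r$ ticks in $(t',t)$. (c) $t\in\mathrm{may}$, and for each $t'<t$ either $d(t')\notin\{t-t',?\}$, or $t'\notin\mathrm{must}$ and $r(t')\in\{\bot,\circ\}$, or $r$ has an event or a gap in $(t',t)$. If all $t'\le t$ are settled, then $z(t)=\square$ for $t\in\mathrm{must}$, $z(t)=\circ$ for $t\in\mathrm{may}\setminus\mathrm{must}$, and $z(t)=\bot$ otherwise. If not, $z(t)=?$. (The abstract domains of the outputs of $\mathrm{unit}^\#$, $\mathrm{time}^\#$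 and $\mathrm{delay}^\#$ contain the concrete values.) **Theorem.** The semantics of the abstract TeSSLa operators can be encoded in TeSSLa using only the concrete operators: for each operator $o^\#$ among $\mathrm{nil}^\#,\mathrm{unit}^\#,\mathrm{time}^\#,\mathrm{lift}^\#(f^\#),\mathrm{last}^\#,\mathrm{delay}^\#$ (over all data abstractions, and all $f^\#$ as above) there is a TeSSLa specification over the concrete operators with two output streams such that, for all abstract event streams $a_1,\dots,a_n$ and all encodings of them as inputs, the specification has a least solution and its outputs encode an abstract event stream $z$ with * $z(t)=o^\#(a_1,\dots,a_n)(t)$ for every $t$ at which all $a_i(t)\neq ?$, and * $z(t)\in\{o^\#(a_1,\dots,a_n)(t),\,?\}$ for all $t$. In particular $z=o^\#(a_1,\dots,a_n)$ if the inputs have infinite progress. -/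

import Mathlib

universe u

namespace TeSSLa

noncomputable section

open scoped Classical

/-! ### Event streams -/

/-- The value of an event stream at a timestamp: an event, `⊥` (known to have no event), or `?`
(after the progress of the stream). -/
inductive Val (D : Type u) : Type u
  | ev (d : D)
  | bot
  | unk

/-- There is an event. -/
def Val.IsEv {D : Type u} (x : Val D) : Prop := ∃ d, x = .ev d

/-- A known value as an element of `D ∪ {⊥}` (only used where the value is not `?`). -/
def Val.toOption {D : Type u} : Val D → Option D
  | .ev d => some d
  | _ => none

/-- An element of `D ∪ {⊥}` as a value. -/
def Val.ofOption {D : Type u} : Option D → Val D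
  | some d => .ev d
  | none => .bot

/-- An event stream, seen as a function on time: what is known is an initial segment of the time
domain, and there are only finitely many events up to a timestamp that is known. -/
structure EventStream (T : Type u) [LinearOrder T] (D : Type u) where
  val : T → Val D
  down : ∀ t t', t' ≤ t → val t ≠ .unk → val t' ≠ .unk
  finite : ∀ t, val t ≠ .unk → {t' | t' ≤ t ∧ (val t').IsEv}.Finite

namespace EventStream

theorem ext_val {T : Type u} [LinearOrder T] {D : Type u} {s r : EventStream T D}
    (h : ∀ t, s.val t = r.val t) : s = r := by
  cases s; cases r
  simp only [mk.injEq]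
  exact funext h

/-- The prefix order. -/
instance {T : Type u} [LinearOrder T] {D : Type u} : PartialOrder (EventStream T D) where
  le s r := ∀ t, s.val t = .unk ∨ s.val t = r.val t
  le_refl s t := Or.inr rfl
  le_trans a b c hab hbc t := by
    rcases hab t with h | h
    · exact Or.inl h
    · rw [h]; exact hbc t
  le_antisymm a b hab hba := by
    refine ext_val fun t => ?_
    rcases hab t with h | h
    · rcases hba t with h' | h'
      · rw [h, h']
      · exact h'.symm
    · exact h

end EventStream

/-- `t' d` is the last event of `v` strictly before `t`. -/
def IsLast {T : Type u} [LinearOrder T] {D : Type u} (v : EventStream T D) (t t' : T) (d : D) :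
    Prop :=
  t' < t ∧ v.val t' = .ev d ∧ ∀ t'', t' < t'' → t'' < t → v.val t'' = .bot

/-! ### The concrete operators -/

section Concrete

variable {T : Type u} [LinearOrder T]

/-- `nil`: no events, infinite progress. -/
def nilOp : EventStream T PEmpty.{u + 1} where
  val _ := .bot
  down _ _ _ _ := by simp
  finite _ _ := by simp [Val.IsEv]

/-- `unit`: a single unit event at time `0`, infinite progress. -/
def unitOp [Zero T] : EventStream T PUnit.{u + 1} where
  val t := if t = 0 then .ev PUnit.unit else .bot
  down t t' _ _ := by split <;> simp
  finite t _ := by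
    refine (Set.finite_singleton (0 : T)).subset ?_
    rintro t' ⟨-, d, h⟩
    by_contra hne
    rw [if_neg (by simpa using hne)] at h
    cases h

/-- The pointwise part of `time`. -/
def timeVal {D : Type u} (t : T) : Val D → Val T
  | .ev _ => .ev t
  | .bot => .bot
  | .unk => .unk

/-- `time`: replaces the values of the events by their timestamps. -/
def timeOp {D : Type u} (s : EventStream T D) : EventStream T T where
  val t := timeVal t (s.val t)
  down t t' h := by
    have := s.down t t' h
    cases h1 : s.val t <;> cases h2 : s.val t' <;> simp_all [timeVal]
  finite t ht := by
    have h0 : s.val t ≠ .unk := by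
      intro h; rw [h] at ht; exact ht rfl
    refine (s.finite t h0).subset ?_
    rintro t' ⟨h1, d, h2⟩
    refine ⟨h1, ?_⟩
    cases h3 : s.val t' <;> simp_all [timeVal, Val.IsEv]

/-- `lift f`: applies `f` at every timestamp at which all arguments are known. -/
def liftOp {n : ℕ} {D : Fin n → Type u} {E : Type u} (f : (∀ i, Option (D i)) → Option E)
    (hf : f (fun _ => none) = none) (s : ∀ i, EventStream T (D i)) : EventStream T E where
  val t := if ∀ i, (s i).val t ≠ .unk then .ofOption (f fun i => ((s i).val t).toOption) else .unk
  down t t' h ht := by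
    have h1 : ∀ i, (s i).val t ≠ .unk := by
      by_contra hc; rw [if_neg hc] at ht; exact ht rfl
    rw [if_pos fun i => (s i).down t t' h (h1 i)]
    cases f fun i => ((s i).val t').toOption <;> simp [Val.ofOption]
  finite t ht := by
    have h1 : ∀ i, (s i).val t ≠ .unk := by
      by_contra hc; rw [if_neg hc] at ht; exact ht rfl
    refine (Set.finite_iUnion fun i => (s i).finite t (h1 i)).subset ?_
    rintro t' ⟨h2, d, h3⟩
    by_contra hc
    simp only [Set.mem_iUnion, Set.mem_ofPred_eq, not_exists, not_and] at hc
    have h4 : (fun i => ((s i).val t').toOption) = fun _ => none := by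
      funext i
      have h5 := hc i h2
      cases h6 : (s i).val t' with
      | ev d => exact absurd ⟨d, h6⟩ h5
      | bot => rfl
      | unk => rfl
    rw [if_pos fun i => (s i).down t t' h2 (h1 i), h4, hf] at h3
    cases h3

/-- The output of `last v r` is settled at `t` by the inputs, provided that it is known before. -/
def LastKnown {D D' : Type u} (v : EventStream T D) (r : EventStream T D') (t : T) : Prop :=
  ((r.val t).IsEv ∧ ∃ t' d, IsLast v t t' d) ∨ r.val t = .bot ∨ ∀ t' < t, v.val t' = .bot

/-- `last v r`: the previous value of `v` at every event of `r`. The defining equation refers to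
whether the output is known before `t`; the output is the solution with the largest progress. -/
def lastOp {D D' : Type u} (v : EventStream T D) (r : EventStream T D') : EventStream T D where
  val t :=
    if ∀ t' ≤ t, LastKnown v r t' then
      if h : (r.val t).IsEv ∧ ∃ d t', IsLast v t t' d then .ev h.2.choose else .bot
    else .unk
  down t t' h ht := by
    have h1 : ∀ u ≤ t, LastKnown v r u := by
      by_contra hc; rw [if_neg hc] at ht; exact ht rfl
    rw [if_pos fun u hu => h1 u (hu.trans h)]
    split <;> simp
  finite t ht := by
    have h1 : ∀ u ≤ t, LastKnown v r u := by
      by_contra hc; rw [if_neg hc] at ht; exact ht rfl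
    have key : ∀ t' ≤ t, Val.IsEv (if ∀ u ≤ t', LastKnown v r u then
        (if h : (r.val t').IsEv ∧ ∃ d s, IsLast v t' s d then Val.ev h.2.choose else .bot)
        else Val.unk) → (r.val t').IsEv ∧ ∃ d s, IsLast v t' s d := by
      intro t' h2 h3
      rw [if_pos fun u hu => h1 u (hu.trans h2)] at h3
      by_contra hc
      rw [dif_neg hc] at h3
      obtain ⟨d, hd⟩ := h3
      cases hd
    by_cases hr : r.val t = .unk
    · have h2 : ∀ t' < t, v.val t' = .bot := by
        rcases h1 t le_rfl with h | h | h
        · obtain ⟨⟨d, hd⟩, -⟩ := h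
          rw [hr] at hd; cases hd
        · rw [hr] at h; cases h
        · exact h
      refine Set.finite_empty.subset ?_
      rintro t' ⟨h3, h4⟩
      obtain ⟨-, d, s, hs, hv, -⟩ := key t' h3 h4
      rw [h2 s (hs.trans_le h3)] at hv
      cases hv
    · exact (r.finite t hr).subset fun t' h => ⟨h.1, (key t' h.1 h.2).1⟩

section Delay

variable [Add T] [Zero T]

/-- The timestamps at which `delay d r` emits an event: a delay is set at `t'`, together with an
event of `r` or with an emitted event, it has passed at `t`, and `r` has no event in between. -/
inductive Fires {D : Type u} (d : EventStream T {x : T // x ≠ 0}) (r : EventStream T D) : T → Prop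
  | reset (t' t : T) (δ : {x : T // x ≠ 0}) (hlt : t' < t) (hd : d.val t' = .ev δ)
      (ht : t' + δ.1 = t) (hs : (r.val t').IsEv)
      (hn : ∀ t'', t' < t'' → t'' < t → r.val t'' = .bot) : Fires d r t
  | again (t' t : T) (δ : {x : T // x ≠ 0}) (hlt : t' < t) (hd : d.val t' = .ev δ)
      (ht : t' + δ.1 = t) (hs : Fires d r t')
      (hn : ∀ t'', t' < t'' → t'' < t → r.val t'' = .bot) : Fires d r t

/-- The output of `delay d r` is settled at `t`, provided that it is known before: it has an event
there, or each earlier `t'` is known not to cause one, since the delay given at `t'` does not pass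
at `t`, or no delay can be set at `t'`, or `r` has an event in between. -/
def DelayKnown {D : Type u} (d : EventStream T {x : T // x ≠ 0}) (r : EventStream T D) (t : T) :
    Prop :=
  Fires d r t ∨ ∀ t' < t,
    (d.val t' ≠ .unk ∧ ∀ δ, d.val t' = .ev δ → t' + δ.1 ≠ t) ∨
    (¬ Fires d r t' ∧ r.val t' = .bot) ∨
    ∃ t'', t' < t'' ∧ t'' < t ∧ (r.val t'').IsEv

/-- `delay d r`. The output ends where its events accumulate. -/
def delayOp {D : Type u} (d : EventStream T {x : T // x ≠ 0}) (r : EventStream T D) :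
    EventStream T PUnit.{u + 1} where
  val t :=
    if (∀ t' ≤ t, DelayKnown d r t') ∧ {t' | t' ≤ t ∧ Fires d r t'}.Finite then
      if Fires d r t then .ev PUnit.unit else .bot
    else .unk
  down t t' h ht := by
    have h1 : (∀ t' ≤ t, DelayKnown d r t') ∧ {t' | t' ≤ t ∧ Fires d r t'}.Finite := by
      by_contra hc; rw [if_neg hc] at ht; exact ht rfl
    rw [if_pos ⟨fun u hu => h1.1 u (hu.trans h),
      h1.2.subset fun u hu => ⟨hu.1.trans h, hu.2⟩⟩]
    split <;> simp
  finite t ht := by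
    have h1 : (∀ t' ≤ t, DelayKnown d r t') ∧ {t' | t' ≤ t ∧ Fires d r t'}.Finite := by
      by_contra hc; rw [if_neg hc] at ht; exact ht rfl
    refine h1.2.subset ?_
    rintro t' ⟨h2, x, h3⟩
    refine ⟨h2, ?_⟩
    by_contra hc
    split at h3
    · cases h3
    · cases h3

end Delay

end Concrete

/-! ### Specifications over the concrete operators -/

/-- Expressions over stream variables `x : X` with data domains `ty x`. -/
inductive Expr (T : Type u) [Zero T] {X : Type} (ty : X → Type u) : Type u → Type (u + 1)
  | var (x : X) : Expr T ty (ty x)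
  | nil : Expr T ty PEmpty.{u + 1}
  | unit : Expr T ty PUnit.{u + 1}
  | time {D : Type u} (a : Expr T ty D) : Expr T ty T
  | lift {n : ℕ} {D : Fin n → Type u} {E : Type u} (f : (∀ i, Option (D i)) → Option E)
      (hf : f (fun _ => none) = none) (a : ∀ i, Expr T ty (D i)) : Expr T ty E
  | last {D D' : Type u} (v : Expr T ty D) (r : Expr T ty D') : Expr T ty D
  | delay {D : Type u} (d : Expr T ty {x : T // x ≠ 0}) (r : Expr T ty D) :
      Expr T ty PUnit.{u + 1}

/-- The value of an expression, given the values of the stream variables. -/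
def Expr.eval {T : Type u} [LinearOrder T] [Add T] [Zero T] {X : Type} {ty : X → Type u}
    (env : ∀ x, EventStream T (ty x)) : {D : Type u} → Expr T ty D → EventStream T D
  | _, .var x => env x
  | _, .nil => nilOp
  | _, .unit => unitOp
  | _, .time a => timeOp (a.eval env)
  | _, .lift f hf a => liftOp f hf fun i => (a i).eval env
  | _, .last v r => lastOp (v.eval env) (r.eval env)
  | _, .delay d r => delayOp (d.eval env) (r.eval env)

/-- A specification with input streams indexed by `I`: finitely many stream variables, and for each
of them a (possibly recursive) equation over the inputs and the variables. -/
structure Spec (T : Type u) [Zero T] (I : Type) (inTy : I → Type u) where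
  V : Type
  finite : Finite V
  ty : V → Type u
  eqn : ∀ v, Expr T (Sum.elim inTy ty) (ty v)

namespace Spec

/-- Input streams together with values of the variables. -/
def join {T : Type u} [LinearOrder T] {I V : Type} {inTy : I → Type u} {ty : V → Type u}
    (inp : ∀ i, EventStream T (inTy i)) (env : ∀ v, EventStream T (ty v)) :
    ∀ x : I ⊕ V, EventStream T (Sum.elim inTy ty x)
  | .inl i => inp i
  | .inr v => env v

/-- The semantics of a specification: the least solution of its equations, in the prefix order. -/
def IsSemantics {T : Type u} [LinearOrder T] [Add T] [Zero T] {I : Type} {inTy : I → Type u}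
    (φ : Spec T I inTy) (inp : ∀ i, EventStream T (inTy i)) (env : ∀ v, EventStream T (φ.ty v)) :
    Prop :=
  IsLeast {env' | ∀ v, env' v = (φ.eqn v).eval (join inp env')} env

end Spec

/-! ### Abstract event streams -/

/-- The possible changes of the set of timestamps that are outside of the gaps. -/
inductive Change : Type u
  | inclusiveStart
  | exclusiveStart
  | inclusiveEnd
  | exclusiveEnd
  | pointGap
  | pointEvent

/-- The timestamp of the change itself is outside of the gaps. -/
def Change.AtIn : Change.{u} → Prop
  | .inclusiveStart | .inclusiveEnd | .pointEvent => True
  | .exclusiveStart | .exclusiveEnd | .pointGap => False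

/-- The timestamps right after the change are outside of the gaps. -/
def Change.AfterIn : Change.{u} → Prop
  | .inclusiveStart | .exclusiveStart | .pointGap => True
  | .inclusiveEnd | .exclusiveEnd | .pointEvent => False

/-- A stream of changes puts `t` outside of the gaps: the latest change up to and including `t`
decides, and initially there is no gap. -/
def InDomain {T : Type u} [LinearOrder T] (e : EventStream T Change.{u}) (t : T) : Prop :=
  (∃ c, e.val t = .ev c ∧ c.AtIn) ∨
  (¬ (e.val t).IsEv ∧
    ((∃ t' c, IsLast e t t' c ∧ c.AfterIn) ∨ ∀ t' < t, ¬ (e.val t').IsEv))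

/-- An abstract event stream over the abstract domain `A`: an event stream `s` with the set `Δ` of
timestamps outside of the gaps, a union of intervals whose boundaries are given by the events of an
event stream (which is known as far as `s` is known). -/
structure AbsStream (T : Type u) [LinearOrder T] (A : Type u) where
  s : EventStream T A
  Δ : Set T
  mem_of_ne : ∀ t, s.val t ≠ .bot → t ∈ Δ
  boundaries : ∃ e : EventStream T Change.{u}, ∀ t, s.val t ≠ .unk →
    e.val t ≠ .unk ∧ (t ∈ Δ ↔ InDomain e t)

/-- The pair `(s, e)` of event streams is an encoding of the abstract event stream `a`: the stream
itself, and the changes of its set `Δ`, with the same progress. -/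
def Encodes {T : Type u} [LinearOrder T] {A : Type u} (s : EventStream T A)
    (e : EventStream T Change.{u}) (a : AbsStream T A) : Prop :=
  s = a.s ∧ ∀ t, (e.val t = .unk ↔ s.val t = .unk) ∧
    (s.val t ≠ .unk → (t ∈ a.Δ ↔ InDomain e t))

/-- The elements of `A ∪ {⊥, gap}`. -/
inductive GVal (A : Type u) : Type u
  | ev (a : A)
  | bot
  | gap

/-- The elements of `A ∪ {⊥, gap, ?}`. -/
inductive AVal (A : Type u) : Type u
  | ev (a : A)
  | bot
  | gap
  | unk

/-- There is an event. -/
def AVal.IsEv {A : Type u} (x : AVal A) : Prop := ∃ a, x = .ev a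

/-- A known value (only used where the value is not `?`). -/
def AVal.toGVal {A : Type u} : AVal A → GVal A
  | .ev a => .ev a
  | .gap => .gap
  | _ => .bot

/-- A known value as a value. -/
def AVal.ofGVal {A : Type u} : GVal A → AVal A
  | .ev a => .ev a
  | .bot => .bot
  | .gap => .gap

/-- A value of an event stream as a value of an abstract event stream. -/
def AVal.ofVal {A : Type u} : Val A → AVal A
  | .ev a => .ev a
  | .bot => .bot
  | .unk => .unk

/-- An abstract event stream as a function on time. -/
def AbsStream.view {T : Type u} [LinearOrder T] {A : Type u} (a : AbsStream T A) (t : T) :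
    AVal A :=
  if t ∈ a.Δ then .ofVal (a.s.val t) else .gap

/-! ### Data abstractions -/

/-- A data abstraction of `D`: an abstract domain `A` with an element `⊤` and a concretisation. -/
structure DataAbs (D A : Type u) where
  top : A
  γ : A → Set D
  γ_top : γ top = Set.univ

/-- A data abstraction whose abstract domain contains the concrete values. -/
structure ExactDataAbs (D A : Type u) extends DataAbs D A where
  emb : D → A
  γ_emb : ∀ d, γ (emb d) = {d}

/-- The concretisation on `A ∪ {⊥, gap}`, with values in the subsets of `D ∪ {⊥}`. -/
def DataAbs.γBot {D A : Type u} (α : DataAbs D A) : GVal A → Set (Option D)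
  | .ev a => some '' α.γ a
  | .bot => {none}
  | .gap => Set.univ

/-- `g` is an abstraction of `f`. -/
def IsAbstraction {n : ℕ} {D A : Fin n → Type u} {E B : Type u} (α : ∀ i, DataAbs (D i) (A i))
    (β : DataAbs E B) (f : (∀ i, Option (D i)) → Option E) (g : (∀ i, GVal (A i)) → GVal B) :
    Prop :=
  ∀ (b : ∀ i, GVal (A i)) (x : ∀ i, Option (D i)),
    (∀ i, x i ∈ (α i).γBot (b i)) → f x ∈ β.γBot (g b)

/-! ### The abstract operators, on the functional representation -/

section Abstract

variable {T : Type u} [LinearOrder T]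

/-- Abstract `nil`. -/
def nilAbs {A : Type u} : T → AVal A := fun _ => .bot

/-- Abstract `unit`. -/
def unitAbs [Zero T] {A : Type u} (α : ExactDataAbs PUnit.{u + 1} A) : T → AVal A :=
  fun t => if t = 0 then .ev (α.emb PUnit.unit) else .bot

/-- Abstract `time`. -/
def timeAbs {A B : Type u} (β : ExactDataAbs T B) (s : T → AVal A) : T → AVal B :=
  fun t => match s t with
    | .ev _ => .ev (β.emb t)
    | .bot => .bot
    | .gap => .gap
    | .unk => .unk

/-- Abstract `lift`. -/
def liftAbs {n : ℕ} {A : Fin n → Type u} {B : Type u} (g : (∀ i, GVal (A i)) → GVal B)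
    (s : ∀ i, T → AVal (A i)) : T → AVal B :=
  fun t => if ∀ i, s i t ≠ .unk then .ofGVal (g fun i => (s i t).toGVal) else .unk

/-- `t' a` is the last event of `v` strictly before `t`, with no gap in between. -/
def IsLastAbs {A : Type u} (v : T → AVal A) (t t' : T) (a : A) : Prop :=
  t' < t ∧ v t' = .ev a ∧ ∀ t'', t' < t'' → t'' < t → v t'' = .bot

/-- There is a last event of `v` strictly before `t`, and a gap in between. -/
def LastThenGap {A : Type u} (v : T → AVal A) (t : T) : Prop :=
  ∃ t' < t, (v t').IsEv ∧ (∀ t'', t' < t'' → t'' < t → v t'' = .bot ∨ v t'' = .gap) ∧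
    ∃ t'', t' < t'' ∧ t'' < t ∧ v t'' = .gap

/-- Before `t` there is no event of `v`, but a gap. -/
def OnlyGap {A : Type u} (v : T → AVal A) (t : T) : Prop :=
  (∀ t' < t, v t' = .bot ∨ v t' = .gap) ∧ ∃ t' < t, v t' = .gap

/-- Before `t` there is an event or a gap of `v`. -/
def EventOrGap {A : Type u} (v : T → AVal A) (t : T) : Prop :=
  ∃ t' < t, (v t').IsEv ∨ v t' = .gap

/-- The output of the abstract `last` is settled at `t`, provided that it is known before. -/
def LastAbsKnown {A A' : Type u} (v : T → AVal A) (r : T → AVal A') (t : T) : Prop :=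
  ((r t).IsEv ∧ ((∃ t' a, IsLastAbs v t t' a) ∨ LastThenGap v t ∨ OnlyGap v t)) ∨
  (r t = .gap ∧ EventOrGap v t) ∨
  r t = .bot ∨ ∀ t' < t, v t' = .bot

/-- Abstract `last`. -/
def lastAbs {D A A' : Type u} (α : DataAbs D A) (v : T → AVal A) (r : T → AVal A') : T → AVal A :=
  fun t =>
    if ∀ t' ≤ t, LastAbsKnown v r t' then
      if h : (r t).IsEv ∧ ∃ a t', IsLastAbs v t t' a then .ev h.2.choose
      else if (r t).IsEv ∧ LastThenGap v t then .ev α.top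
      else if r t = .gap ∧ EventOrGap v t then .gap
      else if (r t).IsEv ∧ OnlyGap v t then .gap
      else .bot
    else .unk

section DelayAbs

variable [Add T] [Zero T] {A B : Type u} (α : ExactDataAbs {x : WithTop T // x ≠ 0} A)

/-- The value `x` is the delay from `t'` to `t`. -/
def DelayTo (x : AVal A) (t' t : T) : Prop :=
  ∃ δ : {x : WithTop T // x ≠ 0}, x = .ev (α.emb δ) ∧ (t' : WithTop T) + δ.1 = (t : WithTop T)

/-- The value `x` may stand for the delay from `t'` to `t`. -/
def MaybeDelayTo (x : AVal A) (t' t : T) : Prop :=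
  DelayTo α x t' t ∨ x = .ev α.top ∨ x = .gap

/-- The timestamps at which the abstract `delay` emits an event. -/
inductive MustFire (d : T → AVal A) (r : T → AVal B) : T → Prop
  | reset (t' t : T) (hlt : t' < t) (hd : DelayTo α (d t') t' t) (hs : (r t').IsEv)
      (hn : ∀ t'', t' < t'' → t'' < t → r t'' = .bot) : MustFire d r t
  | again (t' t : T) (hlt : t' < t) (hd : DelayTo α (d t') t' t) (hs : MustFire d r t')
      (hn : ∀ t'', t' < t'' → t'' < t → r t'' = .bot) : MustFire d r t

/-- The timestamps at which the abstract `delay` emits an event or has a gap: a possible delay is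
set together with an event or a gap of `r` or of the output, and `r` has no event in between. -/
inductive MayFire (d : T → AVal A) (r : T → AVal B) : T → Prop
  | reset (t' t : T) (hlt : t' < t) (hd : MaybeDelayTo α (d t') t' t)
      (hs : (r t').IsEv ∨ r t' = .gap)
      (hn : ∀ t'', t' < t'' → t'' < t → r t'' = .bot ∨ r t'' = .gap) : MayFire d r t
  | again (t' t : T) (hlt : t' < t) (hd : MaybeDelayTo α (d t') t' t) (hs : MayFire d r t')
      (hn : ∀ t'', t' < t'' → t'' < t → r t'' = .bot ∨ r t'' = .gap) : MayFire d r t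

/-- Certainly no event at `t`, provided that the output is known before. -/
def NoEvent (d : T → AVal A) (r : T → AVal B) (t : T) : Prop :=
  ∀ t' < t, (d t' ≠ .unk ∧ ¬ MaybeDelayTo α (d t') t' t) ∨
    (¬ MayFire α d r t' ∧ r t' = .bot) ∨
    ∃ t'', t' < t'' ∧ t'' < t ∧ (r t'').IsEv

/-- Possibly no event at `t`, provided that the output is known before. -/
def MaybeBot (d : T → AVal A) (r : T → AVal B) (t : T) : Prop :=
  ∀ t' < t, (d t' ≠ .unk ∧ ¬ DelayTo α (d t') t' t) ∨
    (¬ MustFire α d r t' ∧ (r t' = .bot ∨ r t' = .gap)) ∨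
    ∃ t'', t' < t'' ∧ t'' < t ∧ ((r t'').IsEv ∨ r t'' = .gap)

/-- The output of the abstract `delay` is settled at `t`, provided that it is known before. -/
def DelayAbsKnown (d : T → AVal A) (r : T → AVal B) (t : T) : Prop :=
  MustFire α d r t ∨ NoEvent α d r t ∨ (MayFire α d r t ∧ MaybeBot α d r t)

/-- Abstract `delay`. -/
def delayAbs {U : Type u} (β : ExactDataAbs PUnit.{u + 1} U) (d : T → AVal A) (r : T → AVal B) :
    T → AVal U :=
  fun t =>
    if ∀ t' ≤ t, DelayAbsKnown α d r t' then
      if MustFire α d r t then .ev (β.emb PUnit.unit)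
      else if MayFire α d r t then .gap
      else .bot
    else .unk

end DelayAbs

end Abstract

/-! ### Realizing an abstract operator -/

/-- The operator `F` on abstract event streams can be encoded in TeSSLa: there is a specification
over the concrete operators, with a pair of output streams, such that for all abstract event streams
`a i` and all encodings `(a i).s`, `e i` of them, the outputs encode an abstract event stream `z`
that agrees with `F a` wherever `z` is known, and at every timestamp at which all inputs are
known. -/
def Realizable {T : Type u} [LinearOrder T] [Add T] [Zero T] {n : ℕ} {A : Fin n → Type u}
    {B : Type u} (F : (∀ i, T → AVal (A i)) → T → AVal B) : Prop :=
  ∃ (φ : Spec T (Fin n ⊕ Fin n) (Sum.elim A fun _ => Change.{u}))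
    (outS : Expr T (Sum.elim (Sum.elim A fun _ => Change.{u}) φ.ty) B)
    (outE : Expr T (Sum.elim (Sum.elim A fun _ => Change.{u}) φ.ty) Change.{u}),
    ∀ (a : ∀ i, AbsStream T (A i)) (e : Fin n → EventStream T Change.{u}),
      (∀ i, Encodes (a i).s (e i) (a i)) →
      ∃ (env : ∀ v, EventStream T (φ.ty v)) (z : AbsStream T B),
        φ.IsSemantics (Spec.join (fun i => (a i).s) e) env ∧
        Encodes (outS.eval (Spec.join (Spec.join (fun i => (a i).s) e) env))
          (outE.eval (Spec.join (Spec.join (fun i => (a i).s) e) env)) z ∧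
        (∀ t, z.view t ≠ .unk → z.view t = F (fun i => (a i).view) t) ∧
        ∀ t, (∀ i, (a i).view t ≠ .unk) → z.view t = F (fun i => (a i).view) t

end

end TeSSLa

namespace TeSSLa

noncomputable section

open scoped Classical

set_option linter.unusedSectionVars false

/-! All six operators have two properties. They are causal: the output at `t` depends only on the
inputs up to `t`. And on inputs with infinite progress the output is piecewise constant
(`PiecewiseOn`): outside a locally finite set of breakpoints it takes only the values `⊥` and gap,
and it is constant on intervals without breakpoints. These two properties alone give realizability
(`realizable_of_causal`).

Because `lift` may apply arbitrary functions over arbitrary domains, one recursive variable can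
carry the whole history of the packed inputs. Given a history, `extrapolate` is the output that
would follow if no further input event arrived. It is piecewise constant, and by causality its value
at `t`, computed from the history up to `t`, is the true output at `t` (`extrapolate_hist`). So the
state only has to be refreshed at ticks: at time `0`, at input events, and at the breakpoints of the
current extrapolation. A `delay` armed with the distance to the next breakpoint produces the latter,
and an input event rearms it. At each tick, two pointwise functions of the state read off the output
event and the change of the gap set (`exists_absStream_of_state`).

The equation of the state refers to itself only through `last` and `delay`, hence only to the strict
past. Ticks are locally finite (`ticks_finite`), so an induction over the number of earlier ticks
shows that every solution equals `stateStream` wherever the packed input is known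
(`stateStream_le`). Where the input is unknown, `stateStream` is unknown too; it is itself a
solution (`stateExpr_eval_eq`), hence the least one.

What remains is specific to each operator: to find its breakpoints. For `last` and `delay`, the
breakpoints of the inputs do not suffice. For `last`, one more is the timestamp at which an initial
gap of `v` begins. For `delay`, further ones are the ends of definite delays and the timestamps at
which both arguments have a gap while no event is possible yet. -/

/-! ### Values and expressions -/

/-- Strict application of a function on `D ∪ {⊥}` to two values. -/
def Val.map₂ {D E F : Type u} (f : Option D → Option E → Option F) (x : Val D) (y : Val E) :
    Val F :=
  if x ≠ .unk ∧ y ≠ .unk then .ofOption (f x.toOption y.toOption) else .unk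

theorem Val.map₂_unk_left {D E F : Type u} (f : Option D → Option E → Option F) (y : Val E) :
    Val.map₂ f .unk y = .unk := by
  simp [Val.map₂]

/-- Strict application of a function on events to a value. -/
def Val.bind {D E : Type u} (f : D → Option E) : Val D → Val E
  | .ev d => .ofOption (f d)
  | .bot => .bot
  | .unk => .unk

/-- A unary `lift` that keeps the absence of events. -/
def Expr.lift₁ {T : Type u} [Zero T] {X : Type} {ty : X → Type u} {D E : Type u}
    (f : D → Option E) (a : Expr T ty D) : Expr T ty E :=
  .lift (n := 1) (D := fun _ => D) (fun x => (x 0).bind f) rfl fun _ => a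

/-- A binary `lift`. -/
def Expr.lift₂ {T : Type u} [Zero T] {X : Type} {ty : X → Type u} {D E F : Type u}
    (f : Option D → Option E → Option F) (hf : f none none = none)
    (a : Expr T ty D) (b : Expr T ty E) : Expr T ty F :=
  .lift (n := 2) (D := ![D, E]) (fun x => f (x 0) (x 1)) hf
    (Fin.cons a (Fin.cons b finZeroElim))

section Eval

variable {T : Type u} [LinearOrder T] [Add T] [Zero T] {X : Type} {ty : X → Type u}
  (env : ∀ x, EventStream T (ty x)) {D E F : Type u}

theorem Expr.eval_lift₁ (f : D → Option E) (a : Expr T ty D) (t : T) :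
    ((Expr.lift₁ f a).eval env).val t = ((a.eval env).val t).bind f := by
  simp only [Expr.lift₁, Expr.eval, liftOp]
  cases (a.eval env).val t <;> simp [Val.bind, Val.toOption, Val.ofOption]

theorem Expr.eval_lift₂ (f : Option D → Option E → Option F) (hf : f none none = none)
    (a : Expr T ty D) (b : Expr T ty E) (t : T) :
    ((Expr.lift₂ f hf a b).eval env).val t =
      Val.map₂ f ((a.eval env).val t) ((b.eval env).val t) := by
  simp only [Expr.lift₂, Expr.eval, liftOp, Val.map₂, Fin.forall_fin_two]
  rfl

end Eval

section Core

variable {T : Type u} {P : Type u}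

/-! ### Locally finite sets and histories -/

/-- Finitely many elements below each timestamp. -/
def LocallyFin [LinearOrder T] (C : Set T) : Prop := ∀ t, (C ∩ Set.Iic t).Finite

/-- The events of `p` up to and including `t`. -/
def hist [LinearOrder T] (p : EventStream T P) (t : T) : T → Option P :=
  fun u => if u ≤ t then (p.val u).toOption else none

/-- The events of `p` before `t`. -/
def histLT [LinearOrder T] (p : EventStream T P) (t : T) : T → Option P :=
  fun u => if u < t then (p.val u).toOption else none

theorem Val.toOption_eq_none {D : Type u} {x : Val D} (h : ¬ x.IsEv) : x.toOption = none := by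
  cases x with
  | ev d => exact absurd ⟨d, rfl⟩ h
  | bot => rfl
  | unk => rfl

theorem Val.eq_bot {D : Type u} {x : Val D} (h : ¬ x.IsEv) (h' : x ≠ .unk) : x = .bot := by
  cases x with
  | ev d => exact absurd ⟨d, rfl⟩ h
  | bot => rfl
  | unk => exact absurd rfl h'

theorem Val.not_isEv_bot {D : Type u} : ¬ (Val.bot : Val D).IsEv := by rintro ⟨d, h⟩; cases h

theorem histLT_eq_hist [LinearOrder T] {p : EventStream T P} {t' t : T} (hlt : t' < t)
    (h : ∀ u, t' < u → u < t → ¬ (p.val u).IsEv) : histLT p t = hist p t' := by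
  funext u
  by_cases h1 : u ≤ t'
  · simp [histLT, hist, h1, h1.trans_lt hlt]
  · by_cases h2 : u < t
    · simp [histLT, hist, h1, h2, Val.toOption_eq_none (h u (not_le.1 h1) h2)]
    · simp [histLT, hist, h1, h2]

theorem histLT_eq_hist_self [LinearOrder T] {p : EventStream T P} {t : T}
    (h : ¬ (p.val t).IsEv) : histLT p t = hist p t := by
  funext u
  rcases lt_trichotomy u t with h1 | h1 | h1
  · simp [histLT, hist, h1, h1.le]
  · subst h1; simp [histLT, hist, Val.toOption_eq_none h]
  · simp [histLT, hist, h1.not_gt, h1.not_ge]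

variable [Semiring T] [LinearOrder T]

/-- The timestamps at which the state is updated: the start, the events of the input, and the
timestamps which the history marks. -/
def ticks (p : EventStream T P) (G : (T → Option P) → Set T) : Set T :=
  {t | t = 0 ∨ (p.val t).IsEv ∨ t ∈ G (histLT p t)}

/-- Below a known timestamp there are finitely many input events, hence only finitely many different
histories, and each of them marks finitely many timestamps. -/
theorem ticks_finite {p : EventStream T P} {G : (T → Option P) → Set T}
    (hG : ∀ h, LocallyFin (G h)) {t : T} (ht : p.val t ≠ .unk) :
    (ticks p G ∩ Set.Iic t).Finite := by
  have hE := p.finite t ht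
  set E := {t' | t' ≤ t ∧ (p.val t').IsEv}
  have hH : (histLT p '' Set.Iic t).Finite := by
    -- The history before `w` is `p` restricted to the events before `w`, so it is determined by a
    -- subset of the finite set `E`.
    refine (hE.powerset.image fun W : Set T => fun u =>
      if u ∈ W then (p.val u).toOption else none).subset ?_
    rintro _ ⟨w, hw, rfl⟩
    refine ⟨{u ∈ E | u < w}, fun u hu => hu.1, ?_⟩
    funext u
    simp only [histLT]
    by_cases h1 : u < w
    · by_cases h2 : (p.val u).IsEv
      · have h3 : u ∈ E := ⟨h1.le.trans hw, h2⟩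
        simp [h1, h3]
      · simp [Val.toOption_eq_none h2]
    · simp [h1]
  refine (((Set.finite_singleton (0 : T)).union hE).union
    (hH.biUnion fun h _ => hG h t)).subset ?_
  rintro u ⟨h | h | h, hu⟩
  · exact Or.inl (Or.inl h)
  · exact Or.inl (Or.inr ⟨hu, h⟩)
  · exact Or.inr (Set.mem_biUnion ⟨u, hu, rfl⟩ ⟨h, hu⟩)

variable [IsStrictOrderedRing T] [CanonicallyOrderedAdd T]

/-- Time `0` is always a tick, so a positive timestamp has some earlier tick, and by local
finiteness a latest one. -/
theorem exists_last_tick {p : EventStream T P} {G : (T → Option P) → Set T}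
    (hG : ∀ h, LocallyFin (G h)) {t : T} (ht : p.val t ≠ .unk) (h0 : t ≠ 0) :
    ∃ t' ∈ ticks p G, t' < t ∧ ∀ u, t' < u → u < t → u ∉ ticks p G := by
  have hfin : (ticks p G ∩ Set.Iio t).Finite :=
    (ticks_finite hG ht).subset fun u hu => ⟨hu.1, le_of_lt hu.2⟩
  obtain ⟨m, hm⟩ := hfin.exists_maximal ⟨0, Or.inl rfl, pos_iff_ne_zero.2 h0⟩
  refine ⟨m, hm.prop.1, hm.prop.2, fun u h1 h2 h3 => ?_⟩
  exact h1.not_ge (hm.le_of_ge ⟨h3, h2⟩ h1.le)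

theorem hist_eq_of_ticks {p : EventStream T P} {G : (T → Option P) → Set T} {t' t : T}
    (hlt : t' < t) (h : ∀ u, t' < u → u < t → u ∉ ticks p G) : histLT p t = hist p t' :=
  histLT_eq_hist hlt fun u h1 h2 h3 => h u h1 h2 (Or.inr (Or.inl h3))

/-- The delay from the timestamp `x.1` to the next timestamp marked by the history `x.2`. -/
def nextDelay (G : (T → Option P) → Set T) (x : T × (T → Option P)) : Option {c : T // c ≠ 0} :=
  if h : ∃ c : {c : T // c ≠ 0}, x.1 + c.1 ∈ G x.2 ∧ ∀ u, x.1 < u → u < x.1 + c.1 → u ∉ G x.2 then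
    some h.choose else none

theorem nextDelay_mem {G : (T → Option P) → Set T} {t : T} {h : T → Option P}
    {c : {c : T // c ≠ 0}} (hc : nextDelay G (t, h) = some c) : t + c.1 ∈ G h := by
  unfold nextDelay at hc
  split at hc
  · rename_i hx
    cases hc
    exact hx.choose_spec.1
  · cases hc

/-- The choice in `nextDelay` is harmless: two first marked timestamps after `t` must coincide. -/
theorem nextDelay_eq {G : (T → Option P) → Set T} {t u : T} {h : T → Option P} (htu : t < u)
    (hu : u ∈ G h) (hn : ∀ w, t < w → w < u → w ∉ G h) :
    ∃ c : {c : T // c ≠ 0}, nextDelay G (t, h) = some c ∧ t + c.1 = u := by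
  obtain ⟨c, rfl⟩ := exists_add_of_le htu.le
  have hc0 : c ≠ 0 := by rintro rfl; simp at htu
  have hx : ∃ c : {c : T // c ≠ 0}, t + c.1 ∈ G h ∧ ∀ u, t < u → u < t + c.1 → u ∉ G h :=
    ⟨⟨c, hc0⟩, hu, hn⟩
  refine ⟨hx.choose, ?_, ?_⟩
  · unfold nextDelay; exact dif_pos hx
  · have h1 := hx.choose_spec
    have hpos : t < t + hx.choose.1 :=
      lt_add_of_pos_right t (pos_iff_ne_zero.2 hx.choose.2)
    rcases lt_trichotomy (t + hx.choose.1) (t + c) with h2 | h2 | h2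
    · exact absurd h1.1 (hn _ hpos h2)
    · exact h2
    · exact absurd hu (h1.2 _ htu h2)

/-! ### The generic specification -/

/-- The state: the time of the latest tick, and the history of the input up to it. -/
abbrev State (T P : Type u) : Type u := T × (T → Option P)

/-- The state after a tick. -/
def stepState : Option (T × Option P) → Option (State T P) → Option (State T P)
  | some x, o => some (x.1, fun u => if u = x.1 then x.2 else o.bind fun y => y.2 u)
  | none, _ => none

theorem stepState_none (o : Option (State T P)) : stepState (none : Option (T × Option P)) o = none :=
  rfl

theorem map₂_stepState {x : Val P} {y : Val (State T P)} {t : T} (hx : x ≠ .unk) (hy : y ≠ .unk) :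
    Val.map₂ stepState (Val.map₂ (fun x y => y.map fun t => (t, x)) x (.ev t)) y =
      .ev (t, fun u => if u = t then x.toOption else y.toOption.bind fun z => z.2 u) := by
  cases x <;> cases y <;> simp_all [Val.map₂, Val.toOption, Val.ofOption, stepState]

/-- There is an event of one of two streams. -/
def orUnit {D E : Type u} (x : Option D) (y : Option E) : Option PUnit.{u + 1} :=
  if x.isSome ∨ y.isSome then some PUnit.unit else none

section Exprs

variable {X : Type} {ty : X → Type u}

/-- The start and the events of the input. -/
def resetExpr (p : Expr T ty P) : Expr T ty PUnit.{u + 1} :=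
  .lift₂ orUnit (by simp [orUnit]) p .unit

/-- The timeouts set by the state. -/
def timerExpr (G : (T → Option P) → Set T) (p : Expr T ty P) (S : Expr T ty (State T P)) :
    Expr T ty PUnit.{u + 1} :=
  .delay (.lift₁ (nextDelay G) S) (resetExpr p)

/-- The ticks. -/
def tickExpr (G : (T → Option P) → Set T) (p : Expr T ty P) (S : Expr T ty (State T P)) :
    Expr T ty PUnit.{u + 1} :=
  .lift₂ orUnit (by simp [orUnit]) (resetExpr p) (timerExpr G p S)

/-- The right-hand side of the equation of the state. -/
def stateExpr (G : (T → Option P) → Set T) (p : Expr T ty P) (S : Expr T ty (State T P)) :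
    Expr T ty (State T P) :=
  .lift₂ stepState (stepState_none _)
    (.lift₂ (fun x y => y.map fun t => (t, x)) (by simp) p (.time (tickExpr G p S)))
    (.last S (tickExpr G p S))

end Exprs

/-- The intended value of the state: known where the input is known, with an event at each tick. -/
def stateStream (p : EventStream T P) (G : (T → Option P) → Set T) (hG : ∀ h, LocallyFin (G h)) :
    EventStream T (State T P) where
  val t := if p.val t = .unk then .unk else if t ∈ ticks p G then .ev (t, hist p t) else .bot
  down t t' h ht := by
    have h1 : p.val t ≠ .unk := fun h => ht (if_pos h)
    rw [if_neg (p.down t t' h h1)]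
    split <;> simp
  finite t ht := by
    have h1 : p.val t ≠ .unk := fun h => ht (if_pos h)
    refine (ticks_finite hG h1).subset ?_
    rintro u ⟨h2, x, h3⟩
    rw [if_neg (p.down t u h2 h1)] at h3
    split at h3
    · exact ⟨by assumption, h2⟩
    · cases h3

/-! ### The state stream is the least solution of its equation -/

section Solve

variable {X : Type} {ty : X → Type u} {env : ∀ x, EventStream T (ty x)}
  {G : (T → Option P) → Set T} {hG : ∀ h, LocallyFin (G h)} {p : Expr T ty P}
  {S : Expr T ty (State T P)}

theorem reset_val (t : T) : ((resetExpr p).eval env).val t =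
    if (p.eval env).val t = .unk then .unk else
    if t = 0 ∨ ((p.eval env).val t).IsEv then .ev PUnit.unit else .bot := by
  rw [resetExpr, Expr.eval_lift₂]
  simp only [Val.map₂, Expr.eval, unitOp, orUnit]
  cases (p.eval env).val t <;> by_cases h : t = 0 <;>
    simp [h, Val.toOption, Val.IsEv, Val.ofOption]

theorem reset_isEv {t : T} : (((resetExpr p).eval env).val t).IsEv ↔
    (p.eval env).val t ≠ .unk ∧ (t = 0 ∨ ((p.eval env).val t).IsEv) := by
  rw [reset_val]
  split
  · simp_all [Val.IsEv]
  · split <;> simp_all [Val.IsEv]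

theorem delay_val_of_state {t : T} (h : (S.eval env).val t = (stateStream (p.eval env) G hG).val t)
    (hk : (p.eval env).val t ≠ .unk) (ht : t ∈ ticks (p.eval env) G) :
    ((S.lift₁ (nextDelay G)).eval env).val t =
      .ofOption (nextDelay G (t, hist (p.eval env) t)) := by
  rw [Expr.eval_lift₁, h]
  simp [stateStream, hk, ht, Val.bind]

theorem ofOption_eq_ev {D : Type u} {x : Option D} {d : D} :
    Val.ofOption x = .ev d ↔ x = some d := by
  cases x <;> simp [Val.ofOption]

/-- Timers are armed only at ticks, so the state need only be correct at earlier ticks. Its values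
between ticks play no role, which is what later makes the induction over ticks possible. -/
theorem mem_of_fires {t : T} (hk : (p.eval env).val t ≠ .unk)
    (hS : ∀ w ∈ ticks (p.eval env) G, w < t →
      (S.eval env).val w = (stateStream (p.eval env) G hG).val w) {u : T}
    (hf : Fires ((S.lift₁ (nextDelay G)).eval env) ((resetExpr p).eval env) u) (hu : u ≤ t) :
    u ∈ G (histLT (p.eval env) u) := by
  have key : ∀ (t' u : T) (δ : {x : T // x ≠ 0}), t' < u → u ≤ t → t' ∈ ticks (p.eval env) G →
      ((S.lift₁ (nextDelay G)).eval env).val t' = .ev δ → t' + δ.1 = u →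
      (∀ t'', t' < t'' → t'' < u → ((resetExpr p).eval env).val t'' = .bot) →
      u ∈ G (histLT (p.eval env) u) := by
    intro t' u δ hlt hu ht' hd hδ hn
    have hlt' := hlt.trans_le hu
    rw [delay_val_of_state (hS t' ht' hlt') ((p.eval env).down _ _ hlt'.le hk) ht',
      ofOption_eq_ev] at hd
    -- Without a reset after `t'` there is no input event, so the history before `u` is still the
    -- one with which the timer was armed.
    rw [histLT_eq_hist hlt fun w h1 h2 h3 => ?_, ← hδ]
    · exact nextDelay_mem hd
    · have h4 := hn w h1 h2
      have h5 := (reset_isEv (p := p) (env := env)).2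
        ⟨(p.eval env).down _ _ (h2.le.trans hu) hk, Or.inr h3⟩
      rw [h4] at h5
      exact Val.not_isEv_bot h5
  induction hf with
  | reset t' u δ hlt hd hδ hs hn =>
    refine key t' u δ hlt hu ?_ hd hδ hn
    rcases (reset_isEv.1 hs).2 with h | h
    · exact Or.inl h
    · exact Or.inr (Or.inl h)
  | again t' u δ hlt hd hδ hs hn ih =>
    exact key t' u δ hlt hu (Or.inr (Or.inr (ih (hlt.le.trans hu)))) hd hδ hn

theorem reset_bot_of_not_tick {t : T} (hk : (p.eval env).val t ≠ .unk)
    (ht : t ∉ ticks (p.eval env) G) : ((resetExpr p).eval env).val t = .bot := by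
  rw [reset_val, if_neg hk, if_neg fun h => ht (h.imp_right Or.inl)]

/-- The number of ticks before `t`. -/
def tickCount (p : EventStream T P) (G : (T → Option P) → Set T) (t : T) : ℕ :=
  (ticks p G ∩ Set.Iio t).ncard

theorem tickCount_le {p : EventStream T P} (hG : ∀ h, LocallyFin (G h)) {u t : T}
    (ht : p.val t ≠ .unk) (hut : u ≤ t) : tickCount p G u ≤ tickCount p G t :=
  Set.ncard_le_ncard (fun _ hw => ⟨hw.1, lt_of_lt_of_le hw.2 hut⟩)
    ((ticks_finite hG ht).subset fun _ hu => ⟨hu.1, le_of_lt hu.2⟩)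

theorem tickCount_lt {p : EventStream T P} (hG : ∀ h, LocallyFin (G h)) {u w t : T}
    (ht : p.val t ≠ .unk) (huw : u ≤ w) (hw : w ∈ ticks p G) (hwt : w < t) :
    tickCount p G u < tickCount p G t := by
  refine Set.ncard_lt_ncard ⟨fun x hx => ⟨hx.1, lt_trans (lt_of_lt_of_le hx.2 huw) hwt⟩,
    fun h => ?_⟩ ((ticks_finite hG ht).subset fun _ hu => ⟨hu.1, le_of_lt hu.2⟩)
  exact (lt_of_lt_of_le (h ⟨hw, hwt⟩).2 huw).false

/-- The latest tick before `u` has the history that is still current at `u`, so `u` is its next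
marked timestamp and its timer ends there. That this tick really arms the timer follows by induction
on the number of earlier ticks. -/
theorem fires_of_mem {t : T} (hk : (p.eval env).val t ≠ .unk)
    (hS : ∀ w ∈ ticks (p.eval env) G, w < t →
      (S.eval env).val w = (stateStream (p.eval env) G hG).val w) {u : T} (hu : u ≤ t)
    (hu0 : u ≠ 0) (hm : u ∈ G (histLT (p.eval env) u)) :
    Fires ((S.lift₁ (nextDelay G)).eval env) ((resetExpr p).eval env) u := by
  induction hn : tickCount (p.eval env) G u using Nat.strong_induction_on generalizing u with
  | _ n ih =>
    have hku := (p.eval env).down _ _ hu hk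
    obtain ⟨t', ht', hlt, hno⟩ := exists_last_tick hG hku hu0
    have hh := hist_eq_of_ticks hlt hno
    have hkt := (p.eval env).down _ _ hlt.le hku
    rw [hh] at hm
    obtain ⟨δ, hδ, hδ'⟩ := nextDelay_eq hlt hm fun w h1 h2 h3 => by
      refine hno w h1 h2 (Or.inr (Or.inr ?_))
      rwa [hist_eq_of_ticks h1 fun x hx hx' => hno x hx (hx'.trans h2)]
    have hd : ((S.lift₁ (nextDelay G)).eval env).val t' = .ev δ := by
      rw [delay_val_of_state (hS t' ht' (hlt.trans_le hu)) hkt ht', hδ]; rfl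
    have hbot : ∀ t'', t' < t'' → t'' < u → ((resetExpr p).eval env).val t'' = .bot :=
      fun w h1 h2 => reset_bot_of_not_tick ((p.eval env).down _ _ h2.le hku) (hno w h1 h2)
    by_cases hr : t' = 0 ∨ ((p.eval env).val t').IsEv
    · exact .reset t' u δ hlt hd hδ' (reset_isEv.2 ⟨hkt, hr⟩) hbot
    · push Not at hr
      -- Here `t'` is neither the start nor an input event, so it is itself a marked timestamp. It
      -- fires by induction, and the timer is rearmed by its own output.
      refine .again t' u δ hlt hd hδ' (ih _ ?_ (hlt.le.trans hu) hr.1 ?_ rfl) hbot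
      · rw [← hn]; exact tickCount_lt hG hku le_rfl ht' hlt
      · rcases ht' with h | h | h
        · exact absurd h hr.1
        · exact absurd h hr.2
        · exact h

theorem tick_val {t : T} (hk : (p.eval env).val t ≠ .unk)
    (hS : ∀ w ∈ ticks (p.eval env) G, w < t →
      (S.eval env).val w = (stateStream (p.eval env) G hG).val w) {u : T} (hu : u ≤ t) :
    ((tickExpr G p S).eval env).val u =
      if u ∈ ticks (p.eval env) G then .ev PUnit.unit else .bot := by
  have hmem : ∀ w ≤ t, Fires ((S.lift₁ (nextDelay G)).eval env) ((resetExpr p).eval env) w →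
      w ∈ ticks (p.eval env) G := fun w hw hf => Or.inr (Or.inr (mem_of_fires hk hS hf hw))
  have hkn : ∀ w ≤ u,
      DelayKnown ((S.lift₁ (nextDelay G)).eval env) ((resetExpr p).eval env) w := by
    intro w hw
    by_cases hf : Fires ((S.lift₁ (nextDelay G)).eval env) ((resetExpr p).eval env) w
    · exact Or.inl hf
    refine Or.inr fun x hx => ?_
    have hxt := hx.trans_le (hw.trans hu)
    have hkx := (p.eval env).down _ _ hxt.le hk
    by_cases hq : ¬ Fires ((S.lift₁ (nextDelay G)).eval env) ((resetExpr p).eval env) x ∧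
        ((resetExpr p).eval env).val x = .bot
    · exact Or.inr (Or.inl hq)
    by_cases hr : ∃ t'', x < t'' ∧ t'' < w ∧ (((resetExpr p).eval env).val t'').IsEv
    · exact Or.inr (Or.inr hr)
    left
    -- Only ticks can arm the timer. All other `x` are excluded by the second alternative of
    -- `DelayKnown`, even if the state is unknown there.
    have hxm : x ∈ ticks (p.eval env) G := by
      by_contra hc
      exact hq ⟨fun h => hc (hmem x hxt.le h), reset_bot_of_not_tick hkx hc⟩
    have hd := delay_val_of_state (hS x hxm hxt) hkx hxm
    refine ⟨?_, fun δ hδ he => hf ?_⟩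
    · rw [hd]
      cases nextDelay G (x, hist (p.eval env) x) <;> simp [Val.ofOption]
    · have hbot : ∀ t'', x < t'' → t'' < w → ((resetExpr p).eval env).val t'' = .bot := by
        intro y h1 h2
        refine Val.eq_bot (fun h => hr ⟨y, h1, h2, h⟩) ?_
        rw [reset_val, if_neg ((p.eval env).down _ _ (h2.le.trans (hw.trans hu)) hk)]
        split <;> simp
      by_cases hfx : Fires ((S.lift₁ (nextDelay G)).eval env) ((resetExpr p).eval env) x
      · exact .again x w δ hx hδ he hfx hbot
      · refine .reset x w δ hx hδ he ?_ hbot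
        by_contra hc
        refine hq ⟨hfx, Val.eq_bot hc ?_⟩
        rw [reset_val, if_neg hkx]
        split <;> simp
  -- The output of `delay` would end at an accumulation of its events; as they are all ticks, there
  -- is none.
  have hfin : {w | w ≤ u ∧
      Fires ((S.lift₁ (nextDelay G)).eval env) ((resetExpr p).eval env) w}.Finite :=
    (ticks_finite hG hk).subset fun w hw => ⟨hmem w (hw.1.trans hu) hw.2, hw.1.trans hu⟩
  have hku := (p.eval env).down _ _ hu hk
  have htimer : ((timerExpr G p S).eval env).val u =
      if Fires ((S.lift₁ (nextDelay G)).eval env) ((resetExpr p).eval env) u then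
        .ev PUnit.unit else .bot := by
    simp only [timerExpr, Expr.eval, delayOp]
    rw [if_pos ⟨hkn, hfin⟩]
  rw [tickExpr, Expr.eval_lift₂, htimer, reset_val, if_neg hku]
  by_cases hm : u ∈ ticks (p.eval env) G
  · rw [if_pos hm]
    by_cases h1 : u = 0 ∨ ((p.eval env).val u).IsEv
    · rw [if_pos h1]
      split <;> simp [Val.map₂, orUnit, Val.toOption, Val.ofOption]
    · rw [if_neg h1]
      push Not at h1
      rcases hm with h | h | h
      · exact absurd h h1.1
      · exact absurd h h1.2
      · rw [if_pos (fires_of_mem hk hS hu h1.1 h)]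
        simp [Val.map₂, orUnit, Val.toOption, Val.ofOption]
  · rw [if_neg hm, if_neg fun h => hm (hmem u hu h),
      if_neg fun h => hm (h.imp_right Or.inl)]
    simp [Val.map₂, orUnit, Val.toOption, Val.ofOption]

theorem IsLast.unique {D : Type u} {v : EventStream T D} {t t₁ t₂ : T} {d₁ d₂ : D}
    (h₁ : IsLast v t t₁ d₁) (h₂ : IsLast v t t₂ d₂) : t₁ = t₂ ∧ d₁ = d₂ := by
  obtain ⟨a1, b1, c1⟩ := h₁
  obtain ⟨a2, b2, c2⟩ := h₂
  have : t₁ = t₂ := by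
    rcases lt_trichotomy t₁ t₂ with h | h | h
    · rw [c1 t₂ h a2] at b2; cases b2
    · exact h
    · rw [c2 t₁ h a1] at b1; cases b1
  subst this
  rw [b1] at b2
  cases b2
  exact ⟨rfl, rfl⟩

theorem lastOp_val_ev {D D' : Type u} {v : EventStream T D} {r : EventStream T D'} {t t' : T}
    {d : D} (hk : ∀ w ≤ t, LastKnown v r w) (hr : (r.val t).IsEv) (hl : IsLast v t t' d) :
    (lastOp v r).val t = .ev d := by
  have hx : (r.val t).IsEv ∧ ∃ d t', IsLast v t t' d := ⟨hr, _, _, hl⟩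
  simp only [lastOp]
  rw [if_pos hk, dif_pos hx]
  obtain ⟨s, hs⟩ := hx.2.choose_spec
  rw [(hs.unique hl).2]

theorem lastOp_val_bot {D D' : Type u} {v : EventStream T D} {r : EventStream T D'} {t : T}
    (hk : ∀ w ≤ t, LastKnown v r w) (h : ∀ t' d, (r.val t).IsEv → ¬ IsLast v t t' d) :
    (lastOp v r).val t = .bot := by
  simp only [lastOp]
  rw [if_pos hk, dif_neg]
  rintro ⟨hr, d, t', hl⟩
  exact h t' d hr hl

theorem stateStream_isLast {p : EventStream T P} {S : EventStream T (State T P)} {t' t : T}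
    (hk : p.val t ≠ .unk) (hS : ∀ u < t, S.val u = (stateStream p G hG).val u)
    (ht' : t' ∈ ticks p G) (hlt : t' < t) (hno : ∀ u, t' < u → u < t → u ∉ ticks p G) :
    IsLast S t t' (t', hist p t') := by
  refine ⟨hlt, ?_, fun u h1 h2 => ?_⟩
  · rw [hS t' hlt]
    simp [stateStream, p.down _ _ hlt.le hk, ht']
  · rw [hS u h2]
    simp [stateStream, p.down _ _ h2.le hk, hno u h1 h2]

/-- One unfolding of the equation. At a tick, `last` needs the state on the whole past, since it
must be absent after the previous tick. At other timestamps only the past of earlier ticks matters,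
so the state since the latest tick is never consulted. -/
theorem stateExpr_val {t : T} (hk : (p.eval env).val t ≠ .unk)
    (hS : ∀ u < t, (t ∈ ticks (p.eval env) G ∨ ∃ w ∈ ticks (p.eval env) G, u ≤ w ∧ w < t) →
      (S.eval env).val u = (stateStream (p.eval env) G hG).val u) :
    ((stateExpr G p S).eval env).val t = (stateStream (p.eval env) G hG).val t := by
  have hS' : ∀ w ∈ ticks (p.eval env) G, w < t →
      (S.eval env).val w = (stateStream (p.eval env) G hG).val w :=
    fun w hw hlt => hS w hlt (Or.inr ⟨w, hw, le_rfl, hlt⟩)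
  have htick : ∀ u ≤ t, _ := fun u hu => tick_val hk hS' hu
  have hlast : ∀ w ≤ t, w ∈ ticks (p.eval env) G → w ≠ 0 → ∃ t', t' ∈ ticks (p.eval env) G ∧
      t' < w ∧ (∀ u, t' < u → u < w → u ∉ ticks (p.eval env) G) ∧
      IsLast (S.eval env) w t' (t', hist (p.eval env) t') := by
    intro w hw hm h0
    have hkw := (p.eval env).down _ _ hw hk
    obtain ⟨t', ht', hlt, hno⟩ := exists_last_tick hG hkw h0
    refine ⟨t', ht', hlt, hno, stateStream_isLast (hG := hG) hkw (fun u hu => ?_) ht' hlt hno⟩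
    refine hS u (hu.trans_le hw) ?_
    rcases hw.eq_or_lt with rfl | h
    · exact Or.inl hm
    · exact Or.inr ⟨w, hm, hu.le, h⟩
  have hkn : ∀ w ≤ t, LastKnown (S.eval env) ((tickExpr G p S).eval env) w := by
    intro w hw
    by_cases hm : w ∈ ticks (p.eval env) G
    · by_cases h0 : w = 0
      · subst h0
        exact Or.inr (Or.inr fun u hu => absurd hu (not_lt_of_ge zero_le))
      · obtain ⟨t', -, -, -, hl⟩ := hlast w hw hm h0
        refine Or.inl ⟨?_, t', _, hl⟩
        rw [htick w hw, if_pos hm]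
        exact ⟨_, rfl⟩
    · refine Or.inr (Or.inl ?_)
      rw [htick w hw, if_neg hm]
  have htt := htick t le_rfl
  rw [stateExpr, Expr.eval_lift₂, Expr.eval_lift₂]
  change Val.map₂ stepState (Val.map₂ _ _ (timeVal t (((tickExpr G p S).eval env).val t)))
    ((lastOp (S.eval env) ((tickExpr G p S).eval env)).val t) = _
  by_cases hm : t ∈ ticks (p.eval env) G
  · rw [if_pos hm] at htt
    by_cases h0 : t = 0
    · subst h0
      -- At time `0` there is no previous state; the empty history is the default.
      rw [lastOp_val_bot hkn fun t' d _ h => not_lt_of_ge zero_le h.1, htt]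
      rw [timeVal, map₂_stepState hk (by simp)]
      simp only [stateStream, if_neg hk, if_pos hm]
      congr 2
      funext u
      by_cases hu : u = 0 <;> simp [hist, hu, Val.toOption]
    · obtain ⟨t', ht', hlt, hno, hl⟩ := hlast t le_rfl hm h0
      rw [lastOp_val_ev hkn ⟨_, htt⟩ hl, htt]
      rw [timeVal, map₂_stepState hk (by simp)]
      simp only [stateStream, if_neg hk, if_pos hm]
      congr 2
      funext u
      rw [← hist_eq_of_ticks hlt hno]
      rcases lt_trichotomy u t with h | h | h
      · simp [hist, histLT, h.ne, h, h.le, Val.toOption]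
      · simp [hist, h]
      · simp [hist, histLT, h.ne', h.not_gt, h.not_ge, Val.toOption]
  · rw [if_neg hm] at htt
    rw [htt, lastOp_val_bot hkn fun t' d h _ => by rw [htt] at h; exact Val.not_isEv_bot h]
    simp [Val.map₂, timeVal, stateStream, hk, hm, Val.toOption, Val.ofOption, stepState]

theorem stateExpr_val_unk {t : T} (hk : (p.eval env).val t = .unk) :
    ((stateExpr G p S).eval env).val t = .unk := by
  rw [stateExpr, Expr.eval_lift₂, Expr.eval_lift₂, hk, Val.map₂_unk_left, Val.map₂_unk_left]

theorem stateExpr_eval_eq (hS : S.eval env = stateStream (p.eval env) G hG) :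
    (stateExpr G p S).eval env = stateStream (p.eval env) G hG := by
  refine EventStream.ext_val fun t => ?_
  by_cases hk : (p.eval env).val t = .unk
  · rw [stateExpr_val_unk hk]
    simp [stateStream, hk]
  · exact stateExpr_val hk fun u _ _ => by rw [hS]

theorem stateStream_le (hS : S.eval env = (stateExpr G p S).eval env) :
    stateStream (p.eval env) G hG ≤ S.eval env := by
  have key : ∀ t, (p.eval env).val t ≠ .unk →
      (S.eval env).val t = (stateStream (p.eval env) G hG).val t := by
    intro t hk
    -- Time itself need not be well-founded. The factor `2` leaves room to place a tick after the
    -- other timestamps with the same number of earlier ticks: the tick depends on those, but not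
    -- conversely.
    induction hn : 2 * tickCount (p.eval env) G t + (if t ∈ ticks (p.eval env) G then 1 else 0)
      using Nat.strong_induction_on generalizing t with
    | _ n ih =>
      rw [hS]
      refine stateExpr_val hk fun u hu h => ih _ ?_ u ((p.eval env).down _ _ hu.le hk) rfl
      by_cases hut : u ∈ ticks (p.eval env) G
      · have := tickCount_lt hG hk le_rfl hut hu
        rw [← hn]
        split_ifs <;> omega
      · rcases h with h | ⟨w, hw, huw, hwt⟩
        · have := tickCount_le hG hk hu.le
          rw [← hn, if_neg hut, if_pos h]
          omega
        · have := tickCount_lt hG hk huw hw hwt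
          rw [← hn, if_neg hut]
          omega
  intro t
  by_cases hk : (p.eval env).val t = .unk
  · left; simp [stateStream, hk]
  · exact Or.inr (key t hk).symm

end Solve

end Core

/-! ### Piecewise constant abstract outputs -/

/-- The abstract stream `y` has infinite progress, its events lie in the locally finite set `C`, and
its gaps start and end there. -/
structure PiecewiseOn {T : Type u} [LinearOrder T] {B : Type u} (y : T → AVal B) (C : Set T) :
    Prop where
  locallyFin : LocallyFin C
  known : ∀ t, y t ≠ .unk
  no_event : ∀ t ∉ C, y t = .bot ∨ y t = .gap
  const : ∀ u w, u ≤ w → (∀ x, u ≤ x → x ≤ w → x ∉ C) → y u = y w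

/-- The change with prescribed behaviour at its timestamp and right after it. -/
def mkChange (p q : Prop) : Change.{u} :=
  if p then (if q then .inclusiveStart else .inclusiveEnd)
  else if q then .exclusiveStart else .exclusiveEnd

theorem mkChange_atIn {p q : Prop} : (mkChange.{u} p q).AtIn ↔ p := by
  unfold mkChange; split_ifs <;> simp_all [Change.AtIn]

theorem mkChange_afterIn {p q : Prop} : (mkChange.{u} p q).AfterIn ↔ q := by
  unfold mkChange; split_ifs <;> simp_all [Change.AfterIn]

/-- The event at the current tick. -/
def eventAt {T P B : Type u} (y : (T → Option P) → T → AVal B) (x : State T P) : Option B :=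
  match y x.2 x.1 with
  | .ev b => some b
  | _ => none

/-- The change at the current tick: whether there is a gap there, and whether there is one until the
next tick. -/
def changeAt {T P B : Type u} [LinearOrder T] (y : (T → Option P) → T → AVal B)
    (G : (T → Option P) → Set T) (x : State T P) : Option Change.{u} :=
  some (mkChange (y x.2 x.1 ≠ .gap)
    (∃ u, x.1 < u ∧ (∀ w, x.1 < w → w ≤ u → w ∉ G x.2) ∧ y x.2 u ≠ .gap))

/-! ### Reading the abstract output off the state -/

section Output

variable {T P B : Type u} [Semiring T] [LinearOrder T] [IsStrictOrderedRing T]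
  [CanonicallyOrderedAdd T]

/-- Between ticks the history does not change and marks nothing, so `y` stays `⊥` or stays gap. An
event and a change at each tick therefore describe the output until the next one. -/
theorem exists_absStream_of_state (p : EventStream T P) {y : (T → Option P) → T → AVal B}
    {G : (T → Option P) → Set T} (hG : ∀ h, LocallyFin (G h)) (hy : ∀ h, PiecewiseOn (y h) (G h))
    (s : EventStream T B) (e : EventStream T Change.{u})
    (hs : ∀ t, s.val t = ((stateStream p G hG).val t).bind (eventAt y))
    (he : ∀ t, e.val t = ((stateStream p G hG).val t).bind (changeAt y G)) :
    ∃ z : AbsStream T B, Encodes s e z ∧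
      ∀ t, z.view t = if p.val t = .unk then .unk else y (hist p t) t := by
  have hsunk : ∀ t, s.val t = .unk ↔ p.val t = .unk := by
    intro t
    rw [hs]
    by_cases hk : p.val t = .unk
    · simp [stateStream, hk, Val.bind]
    · by_cases hm : t ∈ ticks p G
      · simp only [stateStream, if_neg hk, if_pos hm, Val.bind]
        cases eventAt y (t, hist p t) <;> simp [Val.ofOption, hk]
      · simp [stateStream, hk, hm, Val.bind]
  have heunk : ∀ t, e.val t = .unk ↔ p.val t = .unk := by
    intro t
    rw [he]
    by_cases hk : p.val t = .unk
    · simp [stateStream, hk, Val.bind]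
    · by_cases hm : t ∈ ticks p G
      · simp [stateStream, hk, hm, Val.bind, changeAt, Val.ofOption]
      · simp [stateStream, hk, hm, Val.bind]
  have hetick : ∀ t, p.val t ≠ .unk → t ∈ ticks p G → ∃ c, changeAt y G (t, hist p t) = some c ∧
      e.val t = .ev c := by
    intro t hk hm
    refine ⟨_, rfl, ?_⟩
    rw [he]
    simp [stateStream, hk, hm, Val.bind, changeAt, Val.ofOption]
  have hbot : ∀ t, p.val t ≠ .unk → t ∉ ticks p G → s.val t = .bot ∧ e.val t = .bot := by
    intro t hk hm
    rw [hs, he]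
    simp [stateStream, hk, hm, Val.bind]
  have hdom : ∀ t, p.val t ≠ .unk → (InDomain e t ↔ y (hist p t) t ≠ .gap) := by
    intro t hk
    by_cases hm : t ∈ ticks p G
    · obtain ⟨c, hc, hec⟩ := hetick t hk hm
      have hc' : c.AtIn ↔ y (hist p t) t ≠ .gap := by
        cases hc
        exact mkChange_atIn
      rw [← hc']
      constructor
      · rintro (⟨c', h1, h2⟩ | ⟨h, -⟩)
        · rw [hec] at h1; cases h1; exact h2
        · exact absurd ⟨c, hec⟩ h
      · exact fun h => Or.inl ⟨c, hec, h⟩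
    · obtain ⟨t', ht', hlt, hno⟩ := exists_last_tick hG hk
        (fun h => hm (Or.inl h))
      have hkt := p.down _ _ hlt.le hk
      obtain ⟨c, hc, hec⟩ := hetick t' hkt ht'
      have hh : hist p t = hist p t' := by
        rw [← hist_eq_of_ticks hlt hno, histLT_eq_hist_self fun h => hm (Or.inr (Or.inl h))]
      have hnoG : ∀ w, t' < w → w ≤ t → w ∉ G (hist p t') := by
        intro w h1 h2 h3
        have hw : w ∈ ticks p G := by
          refine Or.inr (Or.inr ?_)
          rwa [hist_eq_of_ticks h1 fun x hx hx' => hno x hx (hx'.trans_le h2)]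
        rcases h2.eq_or_lt with rfl | h
        · exact hm hw
        · exact hno w h1 h hw
      -- The witness `u` in `changeAt` may lie on either side of `t`; no marked timestamp separates
      -- the two, so `y` has the same value at both.
      have hc' : c.AfterIn ↔ y (hist p t') t ≠ .gap := by
        cases hc
        rw [mkChange_afterIn]
        constructor
        · rintro ⟨u, h1, h2, h3⟩
          rcases le_total u t with h | h
          · rwa [← (hy (hist p t')).const u t h fun x hx hx' => hnoG x (h1.trans_le hx) hx']
          · rwa [(hy (hist p t')).const t u h fun x hx hx' => h2 x (hlt.trans_le hx) hx']
        · exact fun h => ⟨t, hlt, hnoG, h⟩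
      have hlast : IsLast e t t' c := ⟨hlt, hec, fun u h1 h2 =>
        (hbot u (p.down _ _ h2.le hk) (hno u h1 h2)).2⟩
      rw [hh, ← hc']
      have hnb := (hbot t hk hm).2
      constructor
      · rintro (⟨c', h1, -⟩ | ⟨-, ⟨t'', c', h1, h2⟩ | h⟩)
        · rw [hnb] at h1; cases h1
        · rwa [← (h1.unique hlast).2]
        · exact absurd ⟨c, hec⟩ (h t' hlt)
      · exact fun h => Or.inr ⟨by rw [hnb]; exact Val.not_isEv_bot, Or.inl ⟨t', c, hlast, h⟩⟩
  have hsval : ∀ t, p.val t ≠ .unk → y (hist p t) t ≠ .gap →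
      AVal.ofVal (s.val t) = y (hist p t) t := by
    intro t hk hg
    have hyk := (hy (hist p t)).known t
    by_cases hm : t ∈ ticks p G
    · rw [hs]
      simp only [stateStream, if_neg hk, if_pos hm, Val.bind, eventAt]
      cases hyt : y (hist p t) t <;> simp_all [Val.ofOption, AVal.ofVal]
    · rw [(hbot t hk hm).1]
      have hmG : t ∉ G (hist p t) := by
        intro h
        rw [← histLT_eq_hist_self fun h => hm (Or.inr (Or.inl h))] at h
        exact hm (Or.inr (Or.inr h))
      rcases (hy (hist p t)).no_event t hmG with h | h
      · rw [h]; rfl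
      · exact absurd h hg
  -- An abstract stream has no gap where it is unknown, so these timestamps are added to the set.
  refine ⟨⟨s, {t | s.val t = .unk ∨ InDomain e t}, fun t ht => ?_, e, fun t ht => ?_⟩,
    ⟨rfl, fun t => ⟨by rw [heunk, hsunk], fun ht => ?_⟩⟩, fun t => ?_⟩
  · by_cases hk : p.val t = .unk
    · exact Or.inl ((hsunk t).2 hk)
    · refine Or.inr ((hdom t hk).2 fun hg => ht ?_)
      by_cases hm : t ∈ ticks p G
      · rw [hs]
        simp [stateStream, hk, hm, Val.bind, eventAt, hg, Val.ofOption]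
      · exact (hbot t hk hm).1
  · refine ⟨by rwa [Ne, heunk, ← hsunk], ?_⟩
    simp [ht]
  · simp [ht]
  · by_cases hk : p.val t = .unk
    · have h := (hsunk t).2 hk
      simp [AbsStream.view, h, hk, AVal.ofVal]
    · have h := mt (hsunk t).1 hk
      simp only [AbsStream.view, Set.mem_ofPred_eq, h, false_or, hdom t hk, if_neg hk]
      by_cases hg : y (hist p t) t = .gap
      · simp [hg]
      · rw [if_pos hg, hsval t hk hg]

end Output

/-! ### The packed inputs -/

section Inputs

/-- The values of all streams at a timestamp. -/
abbrev Packed {n : ℕ} (A : Fin n → Type u) : Type u :=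
  (∀ i, Option (A i)) × (Fin n → Option Change.{u})

/-- A tuple of values as an event, unless all of them are absent. -/
def packTuple {n : ℕ} {D : Fin n → Type u} (x : ∀ i, Option (D i)) : Option (∀ i, Option (D i)) :=
  if x = fun _ => none then none else some x

/-- The tuple given by an event or its absence. -/
def unpackTuple {n : ℕ} {D : Fin n → Type u} (x : Option (∀ i, Option (D i))) :
    ∀ i, Option (D i) := x.getD fun _ => none

theorem unpackTuple_packTuple {n : ℕ} {D : Fin n → Type u} (x : ∀ i, Option (D i)) :
    unpackTuple (packTuple x) = x := by
  unfold packTuple unpackTuple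
  split
  · rename_i h; exact h.symm
  · rfl

/-- The pair of the values of two streams of tuples. -/
def packPair {n : ℕ} {A : Fin n → Type u} (x : Option (∀ i, Option (A i)))
    (y : Option (Fin n → Option Change.{u})) : Option (Packed A) :=
  if x = none ∧ y = none then none else some (unpackTuple x, unpackTuple y)

/-- The values of all streams given by an event of the packed input or its absence. -/
def unpack {n : ℕ} {A : Fin n → Type u} (x : Option (Packed A)) : Packed A :=
  x.getD (fun _ => none, fun _ => none)

theorem unpack_packPair {n : ℕ} {A : Fin n → Type u} (x : Option (∀ i, Option (A i)))
    (y : Option (Fin n → Option Change.{u})) :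
    unpack (packPair x y) = (unpackTuple x, unpackTuple y) := by
  unfold packPair
  split
  · rename_i h; rw [h.1, h.2]; rfl
  · rfl

variable {T : Type u} {n : ℕ} {A : Fin n → Type u} {V : Type} {ty : V → Type u}

/-- The input stream of events with the given index. -/
def streamVar [Zero T] (A : Fin n → Type u) (ty : V → Type u) (i : Fin n) :
    Expr T (Sum.elim (Sum.elim A fun _ : Fin n => Change.{u}) ty) (A i) :=
  Expr.var (Sum.inl (Sum.inl i))

/-- The input stream of changes with the given index. -/
def changeVar [Zero T] (A : Fin n → Type u) (ty : V → Type u) (i : Fin n) :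
    Expr T (Sum.elim (Sum.elim A fun _ : Fin n => Change.{u}) ty) Change.{u} :=
  Expr.var (Sum.inl (Sum.inr i))

/-- All inputs in one stream. -/
def inputExpr [Zero T] (A : Fin n → Type u) (ty : V → Type u) :
    Expr T (Sum.elim (Sum.elim A fun _ : Fin n => Change.{u}) ty) (Packed A) :=
  .lift₂ packPair (by simp [packPair])
    (.lift packTuple (by simp [packTuple]) (streamVar A ty))
    (.lift (D := fun _ => Change.{u}) packTuple (by simp [packTuple]) (changeVar A ty))

theorem Val.ofOption_ne_unk {D : Type u} (x : Option D) : Val.ofOption x ≠ .unk := by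
  cases x <;> simp [Val.ofOption]

theorem Val.toOption_ofOption {D : Type u} (x : Option D) : (Val.ofOption x).toOption = x := by
  cases x <;> rfl

theorem Val.toOption_injOn {D : Type u} {x y : Val D} (hx : x ≠ .unk) (hy : y ≠ .unk)
    (h : x.toOption = y.toOption) : x = y := by
  cases x <;> cases y <;> simp_all [Val.toOption]

variable [LinearOrder T] [Add T] [Zero T] {s : ∀ i, EventStream T (A i)}
  {e : Fin n → EventStream T Change.{u}} {env : ∀ v, EventStream T (ty v)}

theorem eval_streamVar (i : Fin n) :
    (streamVar A ty i).eval (Spec.join (Spec.join s e) env) = s i :=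
  Expr.eval.eq_1 (Spec.join (Spec.join s e) env) (Sum.inl (Sum.inl i))

theorem eval_changeVar (i : Fin n) :
    (changeVar A ty i).eval (Spec.join (Spec.join s e) env) = e i :=
  Expr.eval.eq_1 (Spec.join (Spec.join s e) env) (Sum.inl (Sum.inr i))

theorem inputExpr_val (t : T) :
    ((inputExpr A ty).eval (Spec.join (Spec.join s e) env)).val t = Val.map₂ packPair
      (if ∀ i, (s i).val t ≠ .unk then .ofOption (packTuple fun i => ((s i).val t).toOption)
        else .unk)
      (if ∀ i, (e i).val t ≠ .unk then .ofOption (packTuple fun i => ((e i).val t).toOption)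
        else .unk) := by
  rw [inputExpr, Expr.eval_lift₂]
  simp only [Expr.eval, liftOp, eval_streamVar, eval_changeVar]

theorem inputExpr_eval_congr (env env' : ∀ v, EventStream T (ty v)) :
    (inputExpr A ty).eval (Spec.join (Spec.join s e) env) =
      (inputExpr A ty).eval (Spec.join (Spec.join s e) env') :=
  EventStream.ext_val fun t => by rw [inputExpr_val, inputExpr_val]

theorem inputExpr_val_known {t : T} (hs : ∀ i, (s i).val t ≠ .unk) (he : ∀ i, (e i).val t ≠ .unk) :
    ((inputExpr A ty).eval (Spec.join (Spec.join s e) env)).val t ≠ .unk ∧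
    unpack (((inputExpr A ty).eval (Spec.join (Spec.join s e) env)).val t).toOption =
      (fun i => ((s i).val t).toOption, fun i => ((e i).val t).toOption) := by
  rw [inputExpr_val, if_pos hs, if_pos he, Val.map₂,
    if_pos ⟨Val.ofOption_ne_unk _, Val.ofOption_ne_unk _⟩, Val.toOption_ofOption,
    Val.toOption_ofOption, Val.toOption_ofOption, unpack_packPair, unpackTuple_packTuple,
    unpackTuple_packTuple]
  exact ⟨Val.ofOption_ne_unk _, rfl⟩

theorem known_of_inputExpr_val {t : T}
    (h : ((inputExpr A ty).eval (Spec.join (Spec.join s e) env)).val t ≠ .unk) :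
    (∀ i, (s i).val t ≠ .unk) ∧ ∀ i, (e i).val t ≠ .unk := by
  rw [inputExpr_val] at h
  by_contra hc
  rw [not_and_or] at hc
  refine h (if_neg ?_)
  rcases hc with hc | hc
  · rw [if_neg hc]; simp
  · rw [if_neg hc]; simp

end Inputs

/-! ### Causal functions with piecewise constant outputs -/

section Causal

variable {T : Type u} [LinearOrder T]

/-- The stream up to `t`, without events afterwards. -/
def EventStream.cut {D : Type u} (s : EventStream T D) (t : T) (ht : s.val t ≠ .unk) :
    EventStream T D where
  val u := if u ≤ t then s.val u else .bot
  down u u' _ _ := by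
    split
    · exact s.down t u' (by assumption) ht
    · simp
  finite u _ := by
    refine (s.finite t ht).subset ?_
    rintro u' ⟨-, h⟩
    split at h
    · exact ⟨by assumption, h⟩
    · exact absurd h Val.not_isEv_bot

theorem InDomain.congr {e e' : EventStream T Change.{u}} {t : T}
    (h : ∀ u ≤ t, e.val u = e'.val u) : InDomain e t → InDomain e' t := by
  rintro (⟨c, h1, h2⟩ | ⟨h1, ⟨t', c, ⟨h2, h3, h4⟩, h5⟩ | h2⟩)
  · exact Or.inl ⟨c, by rw [← h t le_rfl, h1], h2⟩
  · refine Or.inr ⟨by rwa [← h t le_rfl], Or.inl ⟨t', c, ⟨h2, ?_, fun u hu hu' => ?_⟩, h5⟩⟩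
    · rw [← h t' h2.le, h3]
    · rw [← h u hu'.le, h4 u hu hu']
  · exact Or.inr ⟨by rwa [← h t le_rfl], Or.inr fun u hu => by rw [← h u hu.le]; exact h2 u hu⟩

/-- Whether `t` lies in a gap is decided by the changes up to `t`, so the encodings up to `t`
determine the view there. -/
theorem view_eq_of_encodes {A : Type u} {a a' : AbsStream T A} {e e' : EventStream T Change.{u}}
    (he : Encodes a.s e a) (he' : Encodes a'.s e' a') {t : T} (hk : a.s.val t ≠ .unk)
    (hs : a.s.val t = a'.s.val t) (h : ∀ u ≤ t, e.val u = e'.val u) : a.view t = a'.view t := by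
  have h1 : t ∈ a.Δ ↔ t ∈ a'.Δ := by
    rw [(he.2 t).2 hk, (he'.2 t).2 (hs ▸ hk)]
    exact ⟨InDomain.congr h, InDomain.congr fun u hu => (h u hu).symm⟩
  simp only [AbsStream.view, h1, hs]

theorem view_eq_unk_iff {A : Type u} (a : AbsStream T A) (t : T) :
    a.view t = .unk ↔ a.s.val t = .unk := by
  by_cases h : t ∈ a.Δ
  · simp only [AbsStream.view, if_pos h]
    cases a.s.val t <;> simp [AVal.ofVal]
  · have h1 : a.s.val t = .bot := by
      by_contra hc
      exact h (a.mem_of_ne t hc)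
    simp [AbsStream.view, h, h1]

/-- Events and changes after `t` are dropped, so the gap status after `t` is whatever the last
change left. This provides the completion on which the extrapolation rests. -/
theorem exists_cut {A : Type u} {a : AbsStream T A} {e : EventStream T Change.{u}}
    (he : Encodes a.s e a) {t : T} (hk : a.s.val t ≠ .unk) :
    ∃ (a' : AbsStream T A) (e' : EventStream T Change.{u}), Encodes a'.s e' a' ∧
      (∀ u, a'.s.val u = if u ≤ t then a.s.val u else .bot) ∧
      ∀ u, e'.val u = if u ≤ t then e.val u else .bot := by
  have hke : e.val t ≠ .unk := mt (he.2 t).1.1 hk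
  have hd : ∀ u ≤ t, InDomain e u → InDomain (e.cut t hke) u := fun u hu =>
    InDomain.congr fun w hw => (if_pos (hw.trans hu)).symm
  have hks : ∀ u, (a.s.cut t hk).val u ≠ .unk := by
    intro u
    simp only [EventStream.cut]
    split
    · exact a.s.down t u (by assumption) hk
    · simp
  have hkc : ∀ u, (e.cut t hke).val u ≠ .unk := by
    intro u
    simp only [EventStream.cut]
    split
    · exact e.down t u (by assumption) hke
    · simp
  refine ⟨⟨a.s.cut t hk, {u | InDomain (e.cut t hke) u}, fun u hu => ?_, e.cut t hke,
    fun u _ => ⟨hkc u, Iff.rfl⟩⟩, e.cut t hke, ⟨rfl, fun u => ⟨?_, fun _ => Iff.rfl⟩⟩,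
    fun u => rfl, fun u => rfl⟩
  · simp only [EventStream.cut] at hu
    split at hu
    · rename_i h
      exact hd u h (((he.2 u).2 (a.s.down t u h hk)).1 (a.mem_of_ne u hu))
    · exact absurd rfl hu
  · exact ⟨fun h => absurd h (hkc u), fun h => absurd h (hks u)⟩

variable {n : ℕ} {A : Fin n → Type u} {B : Type u}

/-- Encoded abstract streams with infinite progress and the given history. -/
structure IsCompletion (a : ∀ i, AbsStream T (A i)) (e : Fin n → EventStream T Change.{u})
    (h : T → Option (Packed A)) : Prop where
  encodes : ∀ i, Encodes (a i).s (e i) (a i)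
  known : ∀ i t, (a i).s.val t ≠ .unk
  history : ∀ t, unpack (h t) =
    (fun i => ((a i).s.val t).toOption, fun i => ((e i).val t).toOption)

/-- The output of `F` if the input has the given history and no further events. -/
def extrapolate (F : (∀ i, T → AVal (A i)) → T → AVal B) (h : T → Option (Packed A)) :
    T → AVal B :=
  if hv : ∃ a e, IsCompletion a e h then F fun i => (hv.choose i).view else fun _ => .bot

/-- A completion has infinite progress, so the hypothesis applies to it. A history without
completion gets the constant `⊥`, which needs no breakpoints. -/
theorem exists_piecewiseOn_extrapolate {F : (∀ i, T → AVal (A i)) → T → AVal B}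
    (hF : ∀ a : ∀ i, AbsStream T (A i), (∀ i t, (a i).s.val t ≠ .unk) →
      ∃ C, PiecewiseOn (F fun i => (a i).view) C) (h : T → Option (Packed A)) :
    ∃ C, PiecewiseOn (extrapolate F h) C := by
  unfold extrapolate
  split
  · rename_i hv
    obtain ⟨e, he⟩ := hv.choose_spec
    exact hF _ he.known
  · exact ⟨∅, fun t => by simp, by simp, by simp, by simp⟩

/-- The chosen completion may differ from `a` after `t`, but it has the same history up to `t`, and
by causality nothing else matters. -/
theorem extrapolate_hist {F : (∀ i, T → AVal (A i)) → T → AVal B}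
    (hc : ∀ (a b : ∀ i, T → AVal (A i)) t, (∀ i, ∀ u ≤ t, a i u = b i u) → F a t = F b t)
    {a : ∀ i, AbsStream T (A i)} {e : Fin n → EventStream T Change.{u}}
    (he : ∀ i, Encodes (a i).s (e i) (a i)) {p : EventStream T (Packed A)} {t : T}
    (hk : ∀ i, (a i).s.val t ≠ .unk)
    (hp : ∀ u ≤ t, unpack (p.val u).toOption =
      (fun i => ((a i).s.val u).toOption, fun i => ((e i).val u).toOption)) :
    extrapolate F (hist p t) t = F (fun i => (a i).view) t := by
  have hv : ∃ a e, IsCompletion a e (hist p t) := by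
    choose a' e' he' hs' hc' using fun i => exists_cut (he i) (hk i)
    refine ⟨a', e', he', fun i u => ?_, fun u => ?_⟩
    · rw [hs']
      split
      · exact (a i).s.down t u (by assumption) (hk i)
      · simp
    · simp only [hs', hc', hist]
      split
      · exact hp u (by assumption)
      · rfl
  unfold extrapolate
  rw [dif_pos hv]
  obtain ⟨e', he'⟩ := hv.choose_spec
  refine hc _ _ t fun i u hu => ?_
  have hval : ∀ w ≤ t, (hv.choose i).s.val w = (a i).s.val w ∧ (e' i).val w = (e i).val w := by
    intro w hw
    have h1 := he'.history w
    have h2 : (a i).s.val w ≠ .unk := (a i).s.down t w hw (hk i)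
    simp only [hist, if_pos hw] at h1
    rw [hp w hw, Prod.mk.injEq] at h1
    refine ⟨Val.toOption_injOn (he'.known i w) h2 (congrFun h1.1 i).symm,
      Val.toOption_injOn (mt ((he'.encodes i).2 w).1.1 (he'.known i w))
        (mt ((he i).2 w).1.1 h2) (congrFun h1.2 i).symm⟩
  exact view_eq_of_encodes (he'.encodes i) (he i) (he'.known i u) (hval u hu).1
    fun w hw => (hval w (hw.trans hu)).2

end Causal

/-! ### Causal operators with piecewise constant outputs are realizable -/

section Realize

variable {T : Type u} [Semiring T] [LinearOrder T] [IsStrictOrderedRing T]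
  [CanonicallyOrderedAdd T] {n : ℕ} {A : Fin n → Type u} {B : Type u}

/-- The variable of a specification with a single variable. -/
def soleVar {T : Type u} [Zero T] {I : Type} (inTy : I → Type u) (D : Type u) :
    Expr T (Sum.elim inTy fun _ : Unit => D) D :=
  Expr.var (Sum.inr ())

theorem eval_soleVar {I : Type} {inTy : I → Type u} {D : Type u}
    (inp : ∀ i, EventStream T (inTy i)) (env : Unit → EventStream T D) :
    (soleVar inTy D).eval (Spec.join (ty := fun _ : Unit => D) inp env) = env () :=
  Expr.eval.eq_1 (Spec.join (ty := fun _ : Unit => D) inp env) (Sum.inr ())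

/-- A specification with a single variable, the state. -/
def stateSpec (A : Fin n → Type u) (G : (T → Option (Packed A)) → Set T) :
    Spec T (Fin n ⊕ Fin n) (Sum.elim A fun _ => Change.{u}) where
  V := Unit
  finite := inferInstance
  ty _ := State T (Packed A)
  eqn _ := stateExpr G (inputExpr A _) (soleVar _ _)

/-- The output is known exactly where all inputs are. Hence piecewise constancy is needed only for
infinite progress, and the operator's own progress beyond its inputs need not be reproduced. -/
theorem realizable_of_causal {F : (∀ i, T → AVal (A i)) → T → AVal B}
    (hc : ∀ (a b : ∀ i, T → AVal (A i)) t, (∀ i, ∀ u ≤ t, a i u = b i u) → F a t = F b t)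
    (hF : ∀ a : ∀ i, AbsStream T (A i), (∀ i t, (a i).s.val t ≠ .unk) →
      ∃ C, PiecewiseOn (F fun i => (a i).view) C) :
    Realizable F := by
  choose G hy using exists_piecewiseOn_extrapolate hF
  have hG : ∀ h, LocallyFin (G h) := fun h => (hy h).locallyFin
  refine ⟨stateSpec A G, .lift₁ (eventAt (extrapolate F)) (soleVar _ _),
    .lift₁ (changeAt (extrapolate F) G) (soleVar _ _),
    fun a e he => ?_⟩
  set ty : Unit → Type u := fun _ => State T (Packed A)
  -- An arbitrary value of the variable: the packed input does not depend on it.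
  let env₀ : ∀ v : Unit, EventStream T (ty v) := fun _ => stateStream ⟨fun _ => .bot, by simp, by
    simp [Val.IsEv]⟩ G hG
  set p := (inputExpr A ty).eval (Spec.join (Spec.join (fun i => (a i).s) e) env₀)
  let env : ∀ v : Unit, EventStream T (ty v) := fun _ => stateStream p G hG
  have hek : ∀ i t, (a i).s.val t ≠ .unk → (e i).val t ≠ .unk :=
    fun i t h => mt ((he i).2 t).1.1 h
  have hval : ∀ t, p.val t ≠ .unk →
      extrapolate F (hist p t) t = F (fun i => (a i).view) t := by
    intro t ht
    have hk := (known_of_inputExpr_val ht).1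
    refine extrapolate_hist hc he hk fun u hu => ?_
    have hku : ∀ i, (a i).s.val u ≠ .unk := fun i => (a i).s.down t u hu (hk i)
    exact (inputExpr_val_known hku fun i => hek i u (hku i)).2
  obtain ⟨z, hz, hzv⟩ := exists_absStream_of_state p hG hy
    ((Expr.lift₁ (eventAt (extrapolate F)) (soleVar _ _)).eval
      (Spec.join (Spec.join (fun i => (a i).s) e) env))
    ((Expr.lift₁ (changeAt (extrapolate F) G) (soleVar _ _)).eval
      (Spec.join (Spec.join (fun i => (a i).s) e) env))
    (fun t => by rw [Expr.eval_lift₁, eval_soleVar])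
    (fun t => by rw [Expr.eval_lift₁, eval_soleVar])
  have hmin : ∀ env' : ∀ v : Unit, EventStream T (ty v),
      env' () = (stateExpr G (inputExpr A ty) (soleVar _ _)).eval
        (Spec.join (Spec.join (fun i => (a i).s) e) env') → stateStream p G hG ≤ env' () := by
    intro env' henv'
    have h := stateStream_le (hG := hG) (p := inputExpr A ty) (S := soleVar _ _)
      (env := Spec.join (Spec.join (fun i => (a i).s) e) env')
      ((eval_soleVar _ _).trans henv')
    rwa [inputExpr_eval_congr env' env₀, eval_soleVar] at h
  refine ⟨env, z, ⟨fun _ => ?_, fun env' henv' _ => ?_⟩, hz, fun t ht => ?_, fun t ht => ?_⟩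
  · have hpe := inputExpr_eval_congr (A := A) (ty := ty) (s := fun i => (a i).s) (e := e) env env₀
    refine (stateExpr_eval_eq (hG := hG) (p := inputExpr A ty) (S := soleVar _ _)
      (env := Spec.join (Spec.join (fun i => (a i).s) e) env) ?_).trans ?_ |>.symm
    · rw [hpe, eval_soleVar]
    · rw [hpe]
  · exact hmin env' (henv' ())
  · rw [hzv] at ht ⊢
    split at ht
    · exact absurd rfl ht
    · rename_i hk
      rw [if_neg hk, hval t hk]
  · have hk : ∀ i, (a i).s.val t ≠ .unk := fun i => mt (view_eq_unk_iff (a i) t).2 (ht i)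
    have h := (inputExpr_val_known (ty := ty) (env := env₀) hk fun i => hek i t (hk i)).1
    rw [hzv, if_neg h, hval t h]

end Realize

/-! ### The abstract operators on streams with infinite progress -/

section Piecewise

variable {T : Type u} [LinearOrder T]

theorem LocallyFin.union {C C' : Set T} (h : LocallyFin C) (h' : LocallyFin C') :
    LocallyFin (C ∪ C') := fun t => by
  rw [Set.union_inter_distrib_right]
  exact (h t).union (h' t)

theorem locallyFin_iUnion {n : ℕ} {C : Fin n → Set T} (h : ∀ i, LocallyFin (C i)) :
    LocallyFin (⋃ i, C i) := fun t => by
  rw [Set.iUnion_inter]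
  exact Set.finite_iUnion fun i => h i t

/-- A set that is interleaved with a locally finite set is locally finite. -/
theorem LocallyFin.of_interleaved {C Y : Set T} (hC : LocallyFin C) (hY : ∀ x ∈ Y, x ∉ C)
    (h : ∀ x ∈ Y, ∀ y ∈ Y, x < y → ∃ c ∈ C, x ≤ c ∧ c ≤ y) : LocallyFin Y := by
  have key : ∀ x ∈ Y, ∀ y ∈ Y, x < y → C ∩ Set.Iic x ≠ C ∩ Set.Iic y := by
    intro x hx y hy hlt he
    obtain ⟨c, hc, h1, h2⟩ := h x hx y hy hlt
    have h3 : c ∈ C ∩ Set.Iic x := he ▸ ⟨hc, h2⟩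
    exact hY x hx (le_antisymm h1 h3.2 ▸ hc)
  intro t
  -- Points of `Y` are told apart by the part of `C` below them, and a finite set has finitely many
  -- subsets.
  refine Set.Finite.of_injOn (f := fun x => C ∩ Set.Iic x) (t := 𝒫 (C ∩ Set.Iic t)) ?_ ?_
    (hC t).powerset
  · intro x hx c hc
    exact ⟨hc.1, le_trans hc.2 hx.2⟩
  · intro x hx y hy he
    rcases lt_trichotomy x y with hlt | heq | hlt
    · exact absurd he (key x hx.1 y hy.1 hlt)
    · exact heq
    · exact absurd he.symm (key y hy.1 x hx.1 hlt)

theorem locallyFin_of_subsingleton {Y : Set T} (h : Y.Subsingleton) : LocallyFin Y :=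
  fun _ => h.finite.subset Set.inter_subset_left

theorem AVal.cases_of_ne_unk {A : Type u} {x : AVal A} (h : x ≠ .unk) :
    x.IsEv ∨ x = .bot ∨ x = .gap := by
  cases x <;> simp_all [AVal.IsEv]

theorem AVal.not_isEv {A : Type u} {x : AVal A} (h : x = .bot ∨ x = .gap) : ¬ x.IsEv := by
  rintro ⟨a, rfl⟩
  simp at h

theorem InDomain.iff_of_no_event {e : EventStream T Change.{u}} {u w : T} (huw : u ≤ w)
    (hk : e.val w ≠ .unk) (h : ∀ x, u ≤ x → x ≤ w → ¬ (e.val x).IsEv) :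
    InDomain e u ↔ InDomain e w := by
  have hb : ∀ x, u ≤ x → x ≤ w → e.val x = .bot := fun x h1 h2 =>
    Val.eq_bot (h x h1 h2) (e.down _ _ h2 hk)
  constructor
  · rintro (⟨c, h1, -⟩ | ⟨-, ⟨t', c, ⟨h2, h3, h4⟩, h5⟩ | h2⟩)
    · exact absurd ⟨c, h1⟩ (h u le_rfl huw)
    · refine Or.inr ⟨h w huw le_rfl, Or.inl ⟨t', c, ⟨h2.trans_le huw, h3, fun x hx hx' => ?_⟩, h5⟩⟩
      rcases lt_or_ge x u with hxu | hxu
      · exact h4 x hx hxu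
      · exact hb x hxu hx'.le
    · refine Or.inr ⟨h w huw le_rfl, Or.inr fun x hx => ?_⟩
      rcases lt_or_ge x u with hxu | hxu
      · exact h2 x hxu
      · exact h x hxu hx.le
  · rintro (⟨c, h1, -⟩ | ⟨-, ⟨t', c, ⟨h2, h3, h4⟩, h5⟩ | h2⟩)
    · exact absurd ⟨c, h1⟩ (h w huw le_rfl)
    · have htu : t' < u := by
        by_contra hc
        exact h t' (not_lt.1 hc) h2.le ⟨c, h3⟩
      exact Or.inr ⟨h u le_rfl huw, Or.inl ⟨t', c, ⟨htu, h3, fun x hx hx' =>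
        h4 x hx (hx'.trans_le huw)⟩, h5⟩⟩
    · exact Or.inr ⟨h u le_rfl huw, Or.inr fun x hx => h2 x (hx.trans_le huw)⟩

/-- The breakpoints are the events of the stream and the changes of its gap set. -/
theorem exists_piecewiseOn_view {A : Type u} (a : AbsStream T A) (hk : ∀ t, a.s.val t ≠ .unk) :
    ∃ C, PiecewiseOn a.view C := by
  obtain ⟨e, he⟩ := a.boundaries
  refine ⟨{t | (a.s.val t).IsEv} ∪ {t | (e.val t).IsEv}, LocallyFin.union ?_ ?_, fun t => ?_,
    fun t ht => ?_, fun u w huw h => ?_⟩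
  · exact fun t => (a.s.finite t (hk t)).subset fun x hx => ⟨hx.2, hx.1⟩
  · exact fun t => (e.finite t (he t (hk t)).1).subset fun x hx => ⟨hx.2, hx.1⟩
  · exact mt (view_eq_unk_iff a t).1 (hk t)
  · have h1 : a.s.val t = .bot := Val.eq_bot (fun h => ht (Or.inl h)) (hk t)
    simp only [AbsStream.view, h1, AVal.ofVal]
    split <;> simp
  · have h1 : ∀ x, u ≤ x → x ≤ w → a.s.val x = .bot := fun x h1 h2 =>
      Val.eq_bot (fun h' => h x h1 h2 (Or.inl h')) (hk x)
    have h2 : u ∈ a.Δ ↔ w ∈ a.Δ := by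
      rw [(he u (hk u)).2, (he w (hk w)).2]
      exact InDomain.iff_of_no_event huw (he w (hk w)).1 fun x h1 h2 h' => h x h1 h2 (Or.inr h')
    simp only [AbsStream.view, h2, h1 u le_rfl huw, h1 w huw le_rfl]

theorem PiecewiseOn.timeAbs {A B : Type u} {β : ExactDataAbs T B} {v : T → AVal A} {C : Set T}
    (h : PiecewiseOn v C) : PiecewiseOn (timeAbs β v) C where
  locallyFin := h.locallyFin
  known t := by
    have := h.known t
    unfold TeSSLa.timeAbs
    cases hv : v t <;> simp_all
  no_event t ht := by
    unfold TeSSLa.timeAbs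
    rcases h.no_event t ht with h | h <;> simp [h]
  const u w huw hC := by
    have h1 := h.const u w huw hC
    unfold TeSSLa.timeAbs
    rcases h.no_event w (hC w huw le_rfl) with h | h <;> simp [h1, h]

/-- The tuple without events is among the concretisations of `b`, and `f` maps it to no event; the
concretisation of an abstract event does not contain that value. -/
theorem IsAbstraction.eq_bot_or_gap {n : ℕ} {D A : Fin n → Type u} {E B : Type u}
    {α : ∀ i, DataAbs (D i) (A i)} {β : DataAbs E B} {f : (∀ i, Option (D i)) → Option E}
    {g : (∀ i, GVal (A i)) → GVal B} (hf : f (fun _ => none) = none)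
    (hg : IsAbstraction α β f g) {b : ∀ i, GVal (A i)} (hb : ∀ i, b i = .bot ∨ b i = .gap) :
    g b = .bot ∨ g b = .gap := by
  have h := hg b (fun _ => none) fun i => by
    rcases hb i with h | h <;> simp [h, DataAbs.γBot]
  rw [hf] at h
  cases hgb : g b <;> simp_all [DataAbs.γBot]

theorem piecewiseOn_liftAbs {n : ℕ} {A : Fin n → Type u} {B : Type u}
    {g : (∀ i, GVal (A i)) → GVal B}
    (hg : ∀ b : ∀ i, GVal (A i), (∀ i, b i = .bot ∨ b i = .gap) → g b = .bot ∨ g b = .gap)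
    {v : ∀ i, T → AVal (A i)} {C : Fin n → Set T} (h : ∀ i, PiecewiseOn (v i) (C i)) :
    PiecewiseOn (liftAbs g v) (⋃ i, C i) where
  locallyFin := locallyFin_iUnion fun i => (h i).locallyFin
  known t := by
    unfold liftAbs
    rw [if_pos fun i => (h i).known t]
    cases g fun i => (v i t).toGVal <;> simp [AVal.ofGVal]
  no_event t ht := by
    unfold liftAbs
    rw [if_pos fun i => (h i).known t]
    have h1 := hg (fun i => (v i t).toGVal) fun i => by
      rcases (h i).no_event t (fun hc => ht (Set.mem_iUnion_of_mem i hc)) with h | h <;>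
        simp [h, AVal.toGVal]
    rcases h1 with h | h <;> simp [h, AVal.ofGVal]
  const u w huw hC := by
    have h1 : ∀ i, v i u = v i w := fun i => (h i).const u w huw fun x h1 h2 hc =>
      hC x h1 h2 (Set.mem_iUnion_of_mem i hc)
    simp only [liftAbs, h1]

/-! ### Breakpoints of the abstract `last` -/

section Last

variable {A A' : Type u} {v : T → AVal A} {r : T → AVal A'} {Cv Cr : Set T}

/-- If `v` has an event before `t`, local finiteness gives a latest one, and the cases are whether a
gap follows it. Without an event, anything other than `⊥` before `t` is a gap. -/
theorem lastAbsKnown_of_known {t : T} (hv : PiecewiseOn v Cv) (hr : r t ≠ .unk) : LastAbsKnown v r t := by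
  by_cases hb : ∀ t' < t, v t' = .bot
  · exact Or.inr (Or.inr (Or.inr hb))
  push Not at hb
  obtain ⟨x, hx, hvx⟩ := hb
  have hvx' : (v x).IsEv ∨ v x = .gap := by
    rcases AVal.cases_of_ne_unk (hv.known x) with h | h | h
    · exact Or.inl h
    · exact absurd h hvx
    · exact Or.inr h
  rcases AVal.cases_of_ne_unk hr with h | h | h
  · refine Or.inl ⟨h, ?_⟩
    by_cases hev : ∃ t' < t, (v t').IsEv
    · have hfin : {t' | t' < t ∧ (v t').IsEv}.Finite := by
        refine (hv.locallyFin t).subset fun y hy => ⟨?_, hy.1.le⟩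
        by_contra hc
        exact AVal.not_isEv (hv.no_event y hc) hy.2
      obtain ⟨m, hm⟩ := hfin.exists_maximal hev
      have hno : ∀ y, m < y → y < t → v y = .bot ∨ v y = .gap := by
        intro y h1 h2
        rcases AVal.cases_of_ne_unk (hv.known y) with h | h
        · exact absurd (hm.le_of_ge ⟨h2, h⟩ h1.le) h1.not_ge
        · exact h
      obtain ⟨hmt, a, ha⟩ := hm.prop
      by_cases hg : ∃ y, m < y ∧ y < t ∧ v y = .gap
      · exact Or.inr (Or.inl ⟨m, hmt, ⟨a, ha⟩, hno, hg⟩)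
      · refine Or.inl ⟨m, a, hmt, ha, fun y h1 h2 => ?_⟩
        rcases hno y h1 h2 with h | h
        · exact h
        · exact absurd ⟨y, h1, h2, h⟩ hg
    · push Not at hev
      refine Or.inr (Or.inr ⟨fun y hy => ?_, x, hx, hvx'.resolve_left (hev x hx)⟩)
      exact (AVal.cases_of_ne_unk (hv.known y)).resolve_left (hev y hy)
  · exact Or.inr (Or.inr (Or.inl h))
  · exact Or.inr (Or.inl ⟨h, x, hx, hvx'⟩)

theorem lastAbs_of_no_event {D : Type u} {α : DataAbs D A} (hv : PiecewiseOn v Cv)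
    (hr : ∀ t, r t ≠ .unk) {t : T} (h : ¬ (r t).IsEv) :
    lastAbs α v r t = if r t = .gap ∧ EventOrGap v t then .gap else .bot := by
  unfold lastAbs
  rw [if_pos fun w _ => lastAbsKnown_of_known hv (hr w), dif_neg fun hc => h hc.1,
    if_neg fun hc => h hc.1, if_neg (c := (r t).IsEv ∧ OnlyGap v t) fun hc => h hc.1]

theorem exists_piecewiseOn_lastAbs {D : Type u} {α : DataAbs D A} (hv : PiecewiseOn v Cv)
    (hr : PiecewiseOn r Cr) : ∃ C, PiecewiseOn (lastAbs α v r) C := by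
  -- `EventOrGap` looks strictly into the past, so it still fails where an initial gap of `v` begins
  -- and holds right after. That timestamp is unique, and need not be a breakpoint of `v` (it may be
  -- `0`).
  have hY : {u | v u = .gap ∧ ∀ x < u, v x = .bot}.Subsingleton := by
    rintro x ⟨hx, hx'⟩ y ⟨hy, hy'⟩
    rcases lt_trichotomy x y with h | h | h
    · rw [hy' x h] at hx; cases hx
    · exact h
    · rw [hx' y h] at hy; cases hy
  refine ⟨Cv ∪ Cr ∪ {u | v u = .gap ∧ ∀ x < u, v x = .bot},
    (hv.locallyFin.union hr.locallyFin).union (locallyFin_of_subsingleton hY), fun t => ?_,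
    fun t ht => ?_, fun u w huw h => ?_⟩
  · unfold lastAbs
    rw [if_pos fun w _ => lastAbsKnown_of_known hv (hr.known w)]
    split_ifs <;> simp
  · rw [lastAbs_of_no_event hv hr.known
      (AVal.not_isEv (hr.no_event t fun hc => ht (Or.inl (Or.inr hc))))]
    split_ifs <;> simp
  · have hno : ∀ x, u ≤ x → x ≤ w → ¬ (r x).IsEv := fun x h1 h2 =>
      AVal.not_isEv (hr.no_event x fun hc => h x h1 h2 (Or.inl (Or.inr hc)))
    rw [lastAbs_of_no_event hv hr.known (hno u le_rfl huw),
      lastAbs_of_no_event hv hr.known (hno w huw le_rfl),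
      hr.const u w huw fun x h1 h2 hc => h x h1 h2 (Or.inl (Or.inr hc))]
    have he : EventOrGap v u ↔ EventOrGap v w := by
      refine ⟨fun ⟨x, hx, hx'⟩ => ⟨x, hx.trans_le huw, hx'⟩, fun ⟨x, hx, hx'⟩ => ?_⟩
      by_contra hc
      have hux : u ≤ x := by
        by_contra hxu
        exact hc ⟨x, not_le.1 hxu, hx'⟩
      have hxg : v x = .gap :=
        hx'.resolve_left (AVal.not_isEv (hv.no_event x fun hc => h x hux hx.le (Or.inl (Or.inl hc))))
      refine h u le_rfl huw (Or.inr ⟨?_, fun y hy => ?_⟩)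
      · rw [hv.const u x hux fun y h1 h2 hc => h y h1 (h2.trans hx.le) (Or.inl (Or.inl hc)), hxg]
      · rcases AVal.cases_of_ne_unk (hv.known y) with h1 | h1 | h1
        · exact absurd ⟨y, hy, Or.inl h1⟩ hc
        · exact h1
        · exact absurd ⟨y, hy, Or.inr h1⟩ hc
    rw [he]

end Last

end Piecewise

/-! ### Breakpoints of the abstract `delay` -/

section DelayPiecewise

variable {T : Type u} [Semiring T] [LinearOrder T] [IsStrictOrderedRing T]
  [CanonicallyOrderedAdd T] {A B : Type u} {α : ExactDataAbs {x : WithTop T // x ≠ 0} A}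
  {d : T → AVal A} {r : T → AVal B} {Cd Cr : Set T}

theorem ExactDataAbs.emb_injective {D A : Type u} (α : ExactDataAbs D A) :
    Function.Injective α.emb := fun x y h => by
  have h1 := α.γ_emb x
  rw [h, α.γ_emb y] at h1
  exact (Set.singleton_injective h1).symm

theorem MustFire.exists_delayTo {t : T} (h : MustFire α d r t) :
    ∃ t' < t, DelayTo α (d t') t' t := by
  cases h with
  | reset t' _ hlt hd => exact ⟨t', hlt, hd⟩
  | again t' _ hlt hd => exact ⟨t', hlt, hd⟩

/-- A definite delay is an event of `d`, of which there are finitely many up to each timestamp, and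
each has at most one end because `emb` is injective. -/
theorem locallyFin_delayTo (hd : PiecewiseOn d Cd) :
    LocallyFin {x : T | ∃ t' < x, DelayTo α (d t') t' x} := by
  intro t
  refine ((hd.locallyFin t).biUnion (t := fun t' => {x : T | DelayTo α (d t') t' x})
    fun t' _ => Set.Subsingleton.finite ?_).subset ?_
  · rintro x ⟨δ, hδ, hx⟩ y ⟨δ', hδ', hy⟩
    rw [hδ, AVal.ev.injEq] at hδ'
    rw [← α.emb_injective hδ', hx] at hy
    exact WithTop.coe_injective hy
  · rintro x ⟨⟨t', hlt, hx⟩, hxt⟩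
    refine Set.mem_biUnion (x := t') ⟨?_, hlt.le.trans hxt⟩ hx
    by_contra hc
    obtain ⟨δ, hδ, -⟩ := hx
    exact AVal.not_isEv (hd.no_event t' hc) ⟨_, hδ⟩

/-- With all inputs known, an earlier `t'` violating the conditions of `MaybeBot` or `NoEvent` would
be exactly a generator of `MustFire` or `MayFire` at `t`. -/
theorem delayAbsKnown_of_known (hd : ∀ t, d t ≠ .unk) (hr : ∀ t, r t ≠ .unk) (t : T) :
    DelayAbsKnown α d r t := by
  by_cases hm : MustFire α d r t
  · exact Or.inl hm
  by_cases hy : MayFire α d r t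
  · refine Or.inr (Or.inr ⟨hy, fun t' hlt => ?_⟩)
    by_contra hc
    rw [not_or, not_or] at hc
    obtain ⟨h1, h2, h3⟩ := hc
    have hdt : DelayTo α (d t') t' t := by
      by_contra h
      exact h1 ⟨hd t', h⟩
    have hn : ∀ x, t' < x → x < t → r x = .bot := by
      intro x hx hx'
      rcases AVal.cases_of_ne_unk (hr x) with h | h | h
      · exact absurd ⟨x, hx, hx', Or.inl h⟩ h3
      · exact h
      · exact absurd ⟨x, hx, hx', Or.inr h⟩ h3
    by_cases hs : MustFire α d r t'
    · exact hm (.again t' t hlt hdt hs hn)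
    · rcases AVal.cases_of_ne_unk (hr t') with h | h
      · exact hm (.reset t' t hlt hdt h hn)
      · exact h2 ⟨hs, h⟩
  · refine Or.inr (Or.inl fun t' hlt => ?_)
    by_contra hc
    rw [not_or, not_or] at hc
    obtain ⟨h1, h2, h3⟩ := hc
    have hdt : MaybeDelayTo α (d t') t' t := by
      by_contra h
      exact h1 ⟨hd t', h⟩
    have hn : ∀ x, t' < x → x < t → r x = .bot ∨ r x = .gap := by
      intro x hx hx'
      rcases AVal.cases_of_ne_unk (hr x) with h | h
      · exact absurd ⟨x, hx, hx', h⟩ h3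
      · exact h
    by_cases hs : MayFire α d r t'
    · exact hy (.again t' t hlt hdt hs hn)
    · rcases AVal.cases_of_ne_unk (hr t') with h | h | h
      · exact hy (.reset t' t hlt hdt (Or.inl h) hn)
      · exact h2 ⟨hs, h⟩
      · exact hy (.reset t' t hlt hdt (Or.inr h) hn)

/-- A possible delay that is not known to end elsewhere extends beyond its end. -/
theorem MaybeDelayTo.extend {x : AVal A} {t' t u : T} (h : MaybeDelayTo α x t' t)
    (hn : ¬ DelayTo α x t' t) : MaybeDelayTo α x t' u :=
  Or.inr (h.resolve_left hn)

/-- No definite delay ends at `u`, so the delay responsible for `u` is `⊤` or a gap. Such a delay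
may equally end at any later timestamp, as long as `r` has no event. -/
theorem MayFire.mono {u w : T} (huw : u ≤ w)
    (hX : ∀ t' < u, ¬ DelayTo α (d t') t' u)
    (hno : ∀ x, u ≤ x → x < w → r x = .bot ∨ r x = .gap) (h : MayFire α d r u) :
    MayFire α d r w := by
  have key : ∀ t', (∀ t'', t' < t'' → t'' < u → r t'' = .bot ∨ r t'' = .gap) →
      ∀ t'', t' < t'' → t'' < w → r t'' = .bot ∨ r t'' = .gap := by
    intro t' hn x h1 h2
    rcases lt_or_ge x u with h | h
    · exact hn x h1 h
    · exact hno x h h2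
  cases h with
  | reset t' _ hlt hd hs hn =>
    exact .reset t' w (hlt.trans_le huw) (hd.extend (hX t' hlt)) hs (key t' hn)
  | again t' _ hlt hd hs hn =>
    exact .again t' w (hlt.trans_le huw) (hd.extend (hX t' hlt)) hs (key t' hn)

/-- The delay responsible for `w` is indefinite. If it started before `u`, it may also end at `u`.
If it started in between at a reset, then `d` and `r` have a gap there, hence also at `u`, and `hu`
applies. If it started in between at a possible output, induction leads back to one of these cases.
-/
theorem MayFire.of_later (hd : PiecewiseOn d Cd) (hr : PiecewiseOn r Cr) {u w : T} (huw : u ≤ w)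
    (hC : ∀ x, u ≤ x → x ≤ w → x ∉ Cd ∪ Cr)
    (hX : ∀ x, u ≤ x → x ≤ w → ∀ t' < x, ¬ DelayTo α (d t') t' x)
    (hu : d u = .gap → r u = .gap → MayFire α d r u) (h : MayFire α d r w) :
    MayFire α d r u := by
  induction h with
  | reset t' w hlt hdl hs hn =>
    have hdl' := hdl.extend (u := u) (hX w huw le_rfl t' hlt)
    rcases lt_or_ge t' u with h | h
    · exact .reset t' u h hdl' hs fun x h1 h2 => hn x h1 (h2.trans_le huw)
    · have hCt : ∀ x, u ≤ x → x ≤ t' → x ∉ Cd ∪ Cr := fun x h1 h2 => hC x h1 (h2.trans hlt.le)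
      have hrt : r t' = .gap := hs.resolve_left
        (AVal.not_isEv (hr.no_event t' fun hc => hCt t' h le_rfl (Or.inr hc)))
      have hdt : d t' = .gap := by
        rcases hdl.extend (u := u) (hX w huw le_rfl t' hlt) with h1 | h1 | h1
        · obtain ⟨δ, hδ, -⟩ := h1
          exact absurd ⟨_, hδ⟩
            (AVal.not_isEv (hd.no_event t' fun hc => hCt t' h le_rfl (Or.inl hc)))
        · exact absurd ⟨_, h1⟩
            (AVal.not_isEv (hd.no_event t' fun hc => hCt t' h le_rfl (Or.inl hc)))
        · exact h1
      refine hu ?_ ?_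
      · rw [hd.const u t' h fun x h1 h2 hc => hCt x h1 h2 (Or.inl hc), hdt]
      · rw [hr.const u t' h fun x h1 h2 hc => hCt x h1 h2 (Or.inr hc), hrt]
  | again t' w hlt hdl hs hn ih =>
    rcases lt_or_ge t' u with h | h
    · exact .again t' u h (hdl.extend (hX w huw le_rfl t' hlt)) hs
        fun x h1 h2 => hn x h1 (h2.trans_le huw)
    · exact ih h (fun x h1 h2 => hC x h1 (h2.trans hlt.le))
        fun x h1 h2 => hX x h1 (h2.trans hlt.le)

theorem exists_piecewiseOn_delayAbs {U : Type u} {β : ExactDataAbs PUnit.{u + 1} U}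
    (hd : PiecewiseOn d Cd) (hr : PiecewiseOn r Cr) : ∃ C, PiecewiseOn (delayAbs α β d r) C := by
  set X := {x : T | ∃ t' < x, DelayTo α (d t') t' x}
  set Y := {x : T | x ∉ Cd ∪ Cr ∪ X ∧ d x = .gap ∧ r x = .gap ∧ ¬ MayFire α d r x}
  have hC := (hd.locallyFin.union hr.locallyFin).union (locallyFin_delayTo (α := α) hd)
  -- A point `x` of `Y` sets an indefinite delay, so an event is possible at any later `y` until `r`
  -- has an event. Two points of `Y` are thus separated by some other breakpoint.
  have hY : LocallyFin Y := by
    refine hC.of_interleaved (fun x hx => hx.1) fun x hx y hy hlt => ?_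
    by_contra hc
    push Not at hc
    refine hy.2.2.2 (.reset x y hlt (Or.inr (Or.inr hx.2.1)) (Or.inr hx.2.2.1) fun z h1 h2 => ?_)
    exact hr.no_event z fun hz => absurd (hc z (Or.inl (Or.inr hz)) h1.le) h2.not_gt
  have hval : ∀ t, delayAbs α β d r t = if MustFire α d r t then .ev (β.emb PUnit.unit)
      else if MayFire α d r t then .gap else .bot := by
    intro t
    unfold delayAbs
    rw [if_pos fun w _ => delayAbsKnown_of_known hd.known hr.known w]
  have hmust : ∀ t ∉ X, ¬ MustFire α d r t := fun t ht h => ht h.exists_delayTo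
  refine ⟨Cd ∪ Cr ∪ X ∪ Y, hC.union hY, fun t => ?_, fun t ht => ?_, fun u w huw h => ?_⟩
  · rw [hval]
    split_ifs <;> simp
  · rw [hval, if_neg (hmust t fun hc => ht (Or.inl (Or.inr hc)))]
    split_ifs <;> simp
  · have hXn : ∀ x, u ≤ x → x ≤ w → x ∉ X := fun x h1 h2 hc => h x h1 h2 (Or.inl (Or.inr hc))
    have hX : ∀ x, u ≤ x → x ≤ w → ∀ t' < x, ¬ DelayTo α (d t') t' x :=
      fun x h1 h2 t' ht' hc => hXn x h1 h2 ⟨t', ht', hc⟩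
    rw [hval, hval, if_neg (hmust u (hXn u le_rfl huw)), if_neg (hmust w (hXn w huw le_rfl))]
    have he : MayFire α d r u ↔ MayFire α d r w := by
      refine ⟨MayFire.mono huw (hX u le_rfl huw) fun x h1 h2 => ?_, MayFire.of_later hd hr huw
        (fun x h1 h2 hc => h x h1 h2 (Or.inl (Or.inl hc))) hX fun h1 h2 => ?_⟩
      · exact hr.no_event x fun hc => h x h1 h2.le (Or.inl (Or.inl (Or.inr hc)))
      -- If both arguments have a gap at `u` and no event is possible there, then `u` belongs to
      -- `Y`, which the interval avoids.
      · by_contra hc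
        exact h u le_rfl huw (Or.inr ⟨fun hc' => h u le_rfl huw (Or.inl hc'), h1, h2, hc⟩)
    rw [he]

end DelayPiecewise

/-! ### Causality of the abstract operators -/

section Causality

variable {T : Type u} [LinearOrder T] {A A' : Type u} {v v' : T → AVal A} {r r' : T → AVal A'}

theorem IsLastAbs.congr {t t' : T} {a : A} (hv : ∀ u < t, v u = v' u) :
    IsLastAbs v t t' a ↔ IsLastAbs v' t t' a := by
  unfold IsLastAbs
  refine and_congr_right fun h => ?_
  rw [hv t' h]
  exact and_congr_right fun _ => forall₃_congr fun u _ hu => by rw [hv u hu]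

theorem LastThenGap.of_eq {t : T} (hv : ∀ u < t, v u = v' u) (h : LastThenGap v t) :
    LastThenGap v' t := by
  obtain ⟨t', h1, h2, h3, x, h4, h5, h6⟩ := h
  exact ⟨t', h1, hv t' h1 ▸ h2, fun y hy hy' => hv y hy' ▸ h3 y hy hy', x, h4, h5, hv x h5 ▸ h6⟩

theorem OnlyGap.of_eq {t : T} (hv : ∀ u < t, v u = v' u) (h : OnlyGap v t) : OnlyGap v' t := by
  obtain ⟨h1, x, h2, h3⟩ := h
  exact ⟨fun y hy => hv y hy ▸ h1 y hy, x, h2, hv x h2 ▸ h3⟩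

theorem EventOrGap.of_eq {t : T} (hv : ∀ u < t, v u = v' u) (h : EventOrGap v t) :
    EventOrGap v' t := by
  obtain ⟨x, h1, h2⟩ := h
  exact ⟨x, h1, hv x h1 ▸ h2⟩

theorem LastAbsKnown.of_eq {t : T} (hv : ∀ u < t, v u = v' u) (hr : r t = r' t)
    (h : LastAbsKnown v r t) : LastAbsKnown v' r' t := by
  unfold LastAbsKnown
  rw [← hr]
  rcases h with ⟨h1, ⟨t', a, h2⟩ | h2 | h2⟩ | ⟨h1, h2⟩ | h1 | h1
  · exact Or.inl ⟨h1, Or.inl ⟨t', a, (IsLastAbs.congr hv).1 h2⟩⟩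
  · exact Or.inl ⟨h1, Or.inr (Or.inl (h2.of_eq hv))⟩
  · exact Or.inl ⟨h1, Or.inr (Or.inr (h2.of_eq hv))⟩
  · exact Or.inr (Or.inl ⟨h1, h2.of_eq hv⟩)
  · exact Or.inr (Or.inr (Or.inl h1))
  · exact Or.inr (Or.inr (Or.inr fun u hu => hv u hu ▸ h1 u hu))

theorem lastAbs_congr {D : Type u} {α : DataAbs D A} {t : T} (hv : ∀ u ≤ t, v u = v' u)
    (hr : ∀ u ≤ t, r u = r' u) : lastAbs α v r t = lastAbs α v' r' t := by
  have hv1 : ∀ u < t, v u = v' u := fun u hu => hv u hu.le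
  have hv2 : ∀ u < t, v' u = v u := fun u hu => (hv u hu.le).symm
  have h1 : (∀ t' ≤ t, LastAbsKnown v r t') ↔ ∀ t' ≤ t, LastAbsKnown v' r' t' :=
    forall₂_congr fun w hw =>
      ⟨LastAbsKnown.of_eq (fun u hu => hv u (hu.le.trans hw)) (hr w hw),
        LastAbsKnown.of_eq (fun u hu => (hv u (hu.le.trans hw)).symm) (hr w hw).symm⟩
  have h2 : ∀ t' a, IsLastAbs v t t' a ↔ IsLastAbs v' t t' a := fun _ _ => IsLastAbs.congr hv1
  have h3 : LastThenGap v t ↔ LastThenGap v' t := ⟨.of_eq hv1, .of_eq hv2⟩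
  have h4 : OnlyGap v t ↔ OnlyGap v' t := ⟨.of_eq hv1, .of_eq hv2⟩
  have h5 : EventOrGap v t ↔ EventOrGap v' t := ⟨.of_eq hv1, .of_eq hv2⟩
  simp only [lastAbs, h1, h2, h3, h4, h5, hr t le_rfl]

end Causality

section DelayCausality

variable {T : Type u} [Semiring T] [LinearOrder T] [IsStrictOrderedRing T]
  [CanonicallyOrderedAdd T] {A B : Type u} {α : ExactDataAbs {x : WithTop T // x ≠ 0} A}
  {d d' : T → AVal A} {r r' : T → AVal B}

theorem MustFire.of_eq {t : T} (hd : ∀ u < t, d u = d' u) (hr : ∀ u < t, r u = r' u)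
    (h : MustFire α d r t) : MustFire α d' r' t := by
  induction h with
  | reset t' t hlt h1 h2 h3 =>
    exact .reset t' t hlt (hd t' hlt ▸ h1) (hr t' hlt ▸ h2) fun x hx hx' => hr x hx' ▸ h3 x hx hx'
  | again t' t hlt h1 _ h3 ih =>
    exact .again t' t hlt (hd t' hlt ▸ h1)
      (ih (fun u hu => hd u (hu.trans hlt)) fun u hu => hr u (hu.trans hlt))
      fun x hx hx' => hr x hx' ▸ h3 x hx hx'

theorem MayFire.of_eq {t : T} (hd : ∀ u < t, d u = d' u) (hr : ∀ u < t, r u = r' u)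
    (h : MayFire α d r t) : MayFire α d' r' t := by
  induction h with
  | reset t' t hlt h1 h2 h3 =>
    exact .reset t' t hlt (hd t' hlt ▸ h1) (hr t' hlt ▸ h2) fun x hx hx' => hr x hx' ▸ h3 x hx hx'
  | again t' t hlt h1 _ h3 ih =>
    exact .again t' t hlt (hd t' hlt ▸ h1)
      (ih (fun u hu => hd u (hu.trans hlt)) fun u hu => hr u (hu.trans hlt))
      fun x hx hx' => hr x hx' ▸ h3 x hx hx'

theorem DelayAbsKnown.of_eq {t : T} (hd : ∀ u < t, d u = d' u) (hr : ∀ u < t, r u = r' u)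
    (h : DelayAbsKnown α d r t) : DelayAbsKnown α d' r' t := by
  rcases h with h | h | ⟨h, h'⟩
  · exact Or.inl (h.of_eq hd hr)
  · refine Or.inr (Or.inl fun t' hlt => ?_)
    rw [← hd t' hlt, ← hr t' hlt]
    rcases h t' hlt with h1 | ⟨h1, h2⟩ | ⟨x, h1, h2, h3⟩
    · exact Or.inl h1
    · exact Or.inr (Or.inl ⟨mt (MayFire.of_eq (fun u hu => (hd u (hu.trans hlt)).symm)
        fun u hu => (hr u (hu.trans hlt)).symm) h1, h2⟩)
    · exact Or.inr (Or.inr ⟨x, h1, h2, hr x h2 ▸ h3⟩)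
  · refine Or.inr (Or.inr ⟨h.of_eq hd hr, fun t' hlt => ?_⟩)
    rw [← hd t' hlt, ← hr t' hlt]
    rcases h' t' hlt with h1 | ⟨h1, h2⟩ | ⟨x, h1, h2, h3⟩
    · exact Or.inl h1
    · exact Or.inr (Or.inl ⟨mt (MustFire.of_eq (fun u hu => (hd u (hu.trans hlt)).symm)
        fun u hu => (hr u (hu.trans hlt)).symm) h1, h2⟩)
    · exact Or.inr (Or.inr ⟨x, h1, h2, hr x h2 ▸ h3⟩)

theorem delayAbs_congr {U : Type u} {β : ExactDataAbs PUnit.{u + 1} U} {t : T}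
    (hd : ∀ u ≤ t, d u = d' u) (hr : ∀ u ≤ t, r u = r' u) :
    delayAbs α β d r t = delayAbs α β d' r' t := by
  have hd1 : ∀ w ≤ t, ∀ u < w, d u = d' u := fun w hw u hu => hd u (hu.le.trans hw)
  have hr1 : ∀ w ≤ t, ∀ u < w, r u = r' u := fun w hw u hu => hr u (hu.le.trans hw)
  have hd2 : ∀ w ≤ t, ∀ u < w, d' u = d u := fun w hw u hu => (hd1 w hw u hu).symm
  have hr2 : ∀ w ≤ t, ∀ u < w, r' u = r u := fun w hw u hu => (hr1 w hw u hu).symm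
  have h1 : (∀ w ≤ t, DelayAbsKnown α d r w) ↔ ∀ w ≤ t, DelayAbsKnown α d' r' w :=
    forall₂_congr fun w hw => ⟨.of_eq (hd1 w hw) (hr1 w hw), .of_eq (hd2 w hw) (hr2 w hw)⟩
  have h2 : MustFire α d r t ↔ MustFire α d' r' t :=
    ⟨.of_eq (hd1 t le_rfl) (hr1 t le_rfl), .of_eq (hd2 t le_rfl) (hr2 t le_rfl)⟩
  have h3 : MayFire α d r t ↔ MayFire α d' r' t :=
    ⟨.of_eq (hd1 t le_rfl) (hr1 t le_rfl), .of_eq (hd2 t le_rfl) (hr2 t le_rfl)⟩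
  simp only [delayAbs, h1, h2, h3]

end DelayCausality

end

end TeSSLa

/-! ### Causality and breakpoints for each of the six operators -/

theorem theorem3 {T : Type u} [Semiring T] [LinearOrder T] [IsStrictOrderedRing T]
    [CanonicallyOrderedAdd T] :
    -- the abstract nil
    (∀ (A : Type u) (_ : TeSSLa.DataAbs PEmpty.{u + 1} A),
      TeSSLa.Realizable (T := T) (A := ![]) (B := A) fun _ => TeSSLa.nilAbs) ∧
    -- the abstract unit
    (∀ (A : Type u) (α : TeSSLa.ExactDataAbs PUnit.{u + 1} A),
      TeSSLa.Realizable (T := T) (A := ![]) (B := A) fun _ => TeSSLa.unitAbs α) ∧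
    -- the abstract time
    (∀ (D A B : Type u) (_ : TeSSLa.DataAbs D A) (β : TeSSLa.ExactDataAbs T B),
      TeSSLa.Realizable (T := T) (A := ![A]) (B := B) fun s => TeSSLa.timeAbs β (s 0)) ∧
    -- the abstract lift
    (∀ (n : ℕ) (D A : Fin n → Type u) (E B : Type u) (α : ∀ i, TeSSLa.DataAbs (D i) (A i))
      (β : TeSSLa.DataAbs E B) (f : (∀ i, Option (D i)) → Option E)
      (g : (∀ i, TeSSLa.GVal (A i)) → TeSSLa.GVal B),
      f (fun _ => none) = none → TeSSLa.IsAbstraction α β f g →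
      TeSSLa.Realizable (T := T) (A := A) (B := B) fun s => TeSSLa.liftAbs g s) ∧
    -- the abstract last
    (∀ (D D' A A' : Type u) (α : TeSSLa.DataAbs D A) (_ : TeSSLa.DataAbs D' A'),
      TeSSLa.Realizable (T := T) (A := ![A, A']) (B := A)
        fun s => TeSSLa.lastAbs α (s 0) (s 1)) ∧
    -- the abstract delay
    (∀ (D A A' U : Type u) (α : TeSSLa.ExactDataAbs {x : WithTop T // x ≠ 0} A)
      (_ : TeSSLa.DataAbs D A') (β : TeSSLa.ExactDataAbs PUnit.{u + 1} U),
      TeSSLa.Realizable (T := T) (A := ![A, A']) (B := U)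
        fun s => TeSSLa.delayAbs α β (s 0) (s 1)) := by

  refine ⟨fun A _ => ?_, fun A α => ?_, fun D A B _ β => ?_, fun n D A E B α β f g hf hg => ?_,
    fun D D' A A' α _ => ?_, fun D A A' U α _ β => ?_⟩
  · refine TeSSLa.realizable_of_causal (fun _ _ _ _ => rfl) fun _ _ => ⟨∅, ?_, ?_, ?_, ?_⟩
    · exact fun t => by simp
    · exact fun t => by simp [TeSSLa.nilAbs]
    · exact fun t _ => Or.inl rfl
    · exact fun _ _ _ _ => rfl
  · refine TeSSLa.realizable_of_causal (fun _ _ _ _ => rfl) fun _ _ => ⟨{0}, ?_, ?_, ?_, ?_⟩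
    · exact fun t => (Set.finite_singleton 0).subset Set.inter_subset_left
    · intro t
      unfold TeSSLa.unitAbs
      split <;> simp
    · exact fun t ht => Or.inl (if_neg ht)
    · exact fun u w huw h => (if_neg (h u le_rfl huw)).trans (if_neg (h w huw le_rfl)).symm
  · refine TeSSLa.realizable_of_causal (fun a b t h => ?_) fun a ha => ?_
    · simp only [TeSSLa.timeAbs, h 0 t le_rfl]
    · obtain ⟨C, hC⟩ := TeSSLa.exists_piecewiseOn_view (a 0) (ha 0)
      exact ⟨C, hC.timeAbs⟩
  · refine TeSSLa.realizable_of_causal (fun a b t h => ?_) fun a ha => ?_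
    · have hab : ∀ i, a i t = b i t := fun i => h i t le_rfl
      by_cases hk : ∀ i, b i t ≠ .unk
      · have hk' : ∀ i, a i t ≠ .unk := fun i => hab i ▸ hk i
        simp only [TeSSLa.liftAbs, if_pos hk, if_pos hk', hab]
      · have hk' : ¬ ∀ i, a i t ≠ .unk := fun h' => hk fun i => hab i ▸ h' i
        simp only [TeSSLa.liftAbs, if_neg hk, if_neg hk']
    · choose C hC using fun i => TeSSLa.exists_piecewiseOn_view (a i) (ha i)
      exact ⟨_, TeSSLa.piecewiseOn_liftAbs (fun b hb => hg.eq_bot_or_gap hf hb) hC⟩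
  · refine TeSSLa.realizable_of_causal (fun a b t h => ?_) fun a ha => ?_
    · exact TeSSLa.lastAbs_congr (h 0) (h 1)
    · obtain ⟨Cv, hv⟩ := TeSSLa.exists_piecewiseOn_view (a 0) (ha 0)
      obtain ⟨Cr, hr⟩ := TeSSLa.exists_piecewiseOn_view (a 1) (ha 1)
      exact TeSSLa.exists_piecewiseOn_lastAbs hv hr
  · refine TeSSLa.realizable_of_causal (fun a b t h => ?_) fun a ha => ?_
    · exact TeSSLa.delayAbs_congr (h 0) (h 1)
    · obtain ⟨Cd, hd⟩ := TeSSLa.exists_piecewiseOn_view (a 0) (ha 0)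
      obtain ⟨Cr, hr⟩ := TeSSLa.exists_piecewiseOn_view (a 1) (ha 1)
      exact TeSSLa.exists_piecewiseOn_delayAbs hd hr
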